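/- Let $d\ge 3$. For $r>0$ and $(t,x)\in\mathbb R\times\mathbb R^d=\mathbb R^{d+1}$ put $C_r(t,x)=\{(s,y)\in\mathbb R^{d+1}: t\le s\le t+r^2,\ |x-y|\le r\}$ and let $|C_r|$ be its Lebesgue measure. For $q\in(1,d+2]$ and a measurable vector field $b:\mathbb R^{d+1}\to\mathbb R^d$ set $$\|b\|_{E_q}:=\sup_{r>0,\,z\in\mathbb R^{d+1}} r\Bigl(\frac1{|C_r|}\int_{C_r(z)}|b|^q\,ds\,dy\Bigr)^{1/q},$$ and say that $b$ (equivalently, $|b|$) is in the parabolic Morrey class $E_q$ if $\|b\|_{E_q}<\infty$. For $0<\alpha\le 2$ let $$(-\partial_t-\Delta)^{-\alpha/2}h(t,x)=\int_t^\infty\!\!\int_{\mathbb R^d}\frac{1}{(4\pi(s-t))^{d/2}}\,\frac{1}{(s-t)^{(2-\alpha)/2}}\,e^{-\frac{|x-y|^2}{4(s-t)}}\,h(s,y)\,dy\,ds,$$ $$(\partial_t-\Delta)^{-\alpha/2}h(t,x)=\int_{-\infty}^t\!\int_{\mathbb R^d}\frac{1}{(4\pi(t-s))^{d/2}}\,\frac{1}{(t-s)^{(2-\alpha)/2}}\,e^{-\frac{|x-y|^2}{4(t-s)}}\,h(s,y)\,dy\,ds.$$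 Then for every $q\in(1,d+2]$ (in particular for $q>1$ arbitrarily close to $1$) and every $p\in(1,\infty)$ there is a constant $c=c_{d,p,q}$ such that, for every $b\in E_q$ and each of the two signs, the following holds: for every $f\in L^p(\mathbb R^{d+1})$ the integral defining $(\pm\partial_t-\Delta)^{-\frac1{2p}}f$ converges absolutely almost everywhere, and $f\mapsto |b|^{\frac1p}(\pm\partial_t-\Delta)^{-\frac1{2p}}f$ is a bounded linear operator on $L^p(\mathbb R^{d+1})$ with $$\bigl\||b|^{\frac1p}(\pm\partial_t-\Delta)^{-\frac1{2p}}\bigr\|_{L^p(\mathbb R^{d+1})\to L^p(\mathbb R^{d+1})}\le c\,\|b\|_{E_q}^{\frac1p}.$$ -/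

import Mathlib

open MeasureTheory
open scoped ENNReal

noncomputable section

namespace ParabolicMorrey

/-- Space-time `ℝ × ℝ^d`, with the Euclidean norm on `ℝ^d` and Lebesgue measure `volume`.
A point is written `(t, x)`. -/
abbrev SpaceTime (d : ℕ) : Type := ℝ × EuclideanSpace ℝ (Fin d)

/-- The closed parabolic cylinder
`C_r(t, x) = {(s, y) | t ≤ s ≤ t + r ^ 2, |x - y| ≤ r}`. -/
def cylinder {d : ℕ} (r : ℝ) (z : SpaceTime d) : Set (SpaceTime d) :=
  {w | z.1 ≤ w.1 ∧ w.1 ≤ z.1 + r ^ 2 ∧ ‖z.2 - w.2‖ ≤ r}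

/-- The parabolic Morrey norm
`sup_{r > 0, z} r * (|C_r|⁻¹ ∫_{C_r(z)} |b| ^ q) ^ (1 / q)`, with values in `[0, ∞]`. -/
def morreyNorm {d : ℕ} (q : ℝ) (b : SpaceTime d → EuclideanSpace ℝ (Fin d)) : ℝ≥0∞ :=
  ⨆ (r : ℝ) (_ : 0 < r) (z : SpaceTime d),
    ENNReal.ofReal r *
      ((volume (cylinder r z))⁻¹ * ∫⁻ w in cylinder r z, ‖b w‖ₑ ^ q) ^ (1 / q)

/-- The parabolic Morrey class `E_q`. Finiteness of the norm contains local integrability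
of `|b| ^ q`, because every bounded set lies in a cylinder. -/
structure MemMorrey {d : ℕ} (q : ℝ) (b : SpaceTime d → EuclideanSpace ℝ (Fin d)) : Prop where
  aestronglyMeasurable : AEStronglyMeasurable b volume
  morreyNorm_lt_top : morreyNorm q b < ∞

/-- The kernel `(4 π τ)^(-d/2) τ^(-(2 - α)/2) exp (-|y|^2 / (4 τ))` for `τ > 0`, extended by
zero to `τ ≤ 0`. -/
def fracHeatKernel {d : ℕ} (α : ℝ) (w : SpaceTime d) : ℝ :=
  if 0 < w.1 then
    1 / (4 * Real.pi * w.1) ^ ((d : ℝ) / 2) * (1 / w.1 ^ ((2 - α) / 2)) *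
      Real.exp (-‖w.2‖ ^ 2 / (4 * w.1))
  else 0

/-- `(-∂_t - Δ)^(-α/2) h (t, x)`: the integral over `s > t`, `y ∈ ℝ^d` of
`h (s, y)` against the kernel at `(s - t, y - x)`. -/
def backwardPotential {d : ℕ} (α : ℝ) (h : SpaceTime d → ℝ) (z : SpaceTime d) : ℝ :=
  ∫ w, fracHeatKernel α (w - z) * h w

/-- `(∂_t - Δ)^(-α/2) h (t, x)`: the integral over `s < t`, `y ∈ ℝ^d` of
`h (s, y)` against the kernel at `(t - s, x - y)`. -/
def forwardPotential {d : ℕ} (α : ℝ) (h : SpaceTime d → ℝ) (z : SpaceTime d) : ℝ :=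
  ∫ w, fracHeatKernel α (z - w) * h w

end ParabolicMorrey

end

noncomputable section

namespace ParabolicMorrey

/-! Write D = d + 2, α = 1/p, V = |b|. Up to a constant, both heat kernels lie below one symmetric
kernel ∑ₖ 2^(k(α-D)) 1_{Bₖ(z)}(w) (`exists_enorm_fracHeatKernel_le`). So it suffices to prove the
trace inequality ∫ V (I f)^p ≤ C ‖b‖ ∫ f^p for the potential I of that kernel; the p-th root of its
constant bounds the operator norm.

The trace inequality follows from a weighted Schur test (`lintegral_mul_rpow_lintegral_le`) whose
test functions are powers of Φ = supⱼ 2^(jη) avgⱼ(V^q), a fractional maximal function of the weight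
itself with small η > 0. Two facts make this work. Powers Φ^γ with γ ≤ 1 behave like A₁ weights:
their average over Bₖ is at most C Ψₖ^γ, where Ψₖ takes the supremum over radii at least 2^k only
(`exists_dyadicAvg_fracMax_rpow_le`). The normalized Morrey condition gives Ψₖ ≤ min(Φ, 2^(-ks))
with s = q - η (`fracMaxFrom_le`).

Hence I(Φ^γ) is bounded by a two-sided geometric series, which sums to a multiple of Φ^(γ - α/s)
(`exists_tsum_min_le`). For the dual condition, Hölder's inequality separates V = (V^q)^(1/q) from
the power of Φ; this is where q > 1 enters. The exponents of the two conditions match because αp =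
1. -/

lemma two_rpow_mul (x y : ℝ) : (2 : ℝ≥0∞) ^ x * 2 ^ y = 2 ^ (x + y) :=
  (ENNReal.rpow_add _ _ two_ne_zero ENNReal.ofNat_ne_top).symm

lemma two_rpow_rpow (x y : ℝ) : ((2 : ℝ≥0∞) ^ x) ^ y = 2 ^ (x * y) :=
  (ENNReal.rpow_mul _ _ _).symm

lemma two_rpow_ne_top (x : ℝ) : (2 : ℝ≥0∞) ^ x ≠ ∞ :=
  ENNReal.rpow_ne_top_of_ne_zero two_ne_zero ENNReal.ofNat_ne_top

lemma two_rpow_ne_zero (x : ℝ) : (2 : ℝ≥0∞) ^ x ≠ 0 := by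
  simp [ENNReal.rpow_eq_zero_iff]

lemma two_rpow_le {x y : ℝ} (h : x ≤ y) : (2 : ℝ≥0∞) ^ x ≤ 2 ^ y :=
  ENNReal.rpow_le_rpow_of_exponent_le one_le_two h

lemma ofReal_two_zpow (k : ℤ) : ENNReal.ofReal ((2 : ℝ) ^ k) = 2 ^ (k : ℝ) := by
  rw [← Real.rpow_intCast, ← ENNReal.ofReal_rpow_of_pos two_pos]
  simp

/-! ### Geometric sums -/

lemma tsum_two_rpow_neg_nat_ne_top {ε : ℝ} (hε : 0 < ε) :
    ∑' n : ℕ, (2 : ℝ≥0∞) ^ (-(n * ε)) ≠ ∞ := by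
  have h : ∀ n : ℕ, (2 : ℝ≥0∞) ^ (-(n * ε)) = ((2 : ℝ≥0∞) ^ (-ε)) ^ n := by
    intro n
    rw [← ENNReal.rpow_natCast, two_rpow_rpow]
    congr 1; ring
  simp_rw [h, ENNReal.tsum_geometric]
  have : (2 : ℝ≥0∞) ^ (-ε) < 1 := by
    rw [ENNReal.rpow_neg, ENNReal.inv_lt_one]
    exact ENNReal.one_lt_rpow (by norm_num) hε
  simp only [ne_eq, ENNReal.inv_eq_top, tsub_eq_zero_iff_le, not_le]
  exact this

lemma tsum_two_rpow_neg_abs_ne_top {ε : ℝ} (hε : 0 < ε) :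
    ∑' n : ℤ, (2 : ℝ≥0∞) ^ (-(|(n : ℝ)| * ε)) ≠ ∞ := by
  rw [tsum_of_nat_of_neg_add_one ENNReal.summable ENNReal.summable]
  refine ENNReal.add_ne_top.2 ⟨?_, ?_⟩
  · simpa using tsum_two_rpow_neg_nat_ne_top hε
  · refine ne_top_of_le_ne_top (tsum_two_rpow_neg_nat_ne_top hε) ?_
    refine ENNReal.tsum_le_tsum fun n => two_rpow_le ?_
    have : |((-((n : ℤ) + 1) : ℤ) : ℝ)| = n + 1 := by
      push_cast
      rw [abs_neg, abs_of_nonneg (by positivity)]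
    rw [this]
    nlinarith

/-- A two-sided geometric sum, balanced at the index where `2 ^ (-k s)` crosses `Φ`. -/
lemma exists_tsum_min_le {a s β : ℝ} (ha : 0 < a) (hs : 0 < s) (hβ : a < s * β) :
    ∃ C : ℝ≥0∞, C ≠ ∞ ∧ ∀ Φ : ℝ≥0∞,
      ∑' k : ℤ, (2 : ℝ≥0∞) ^ (k * a) * (min Φ (2 ^ (-(k * s)))) ^ β ≤ C * Φ ^ (β - a / s) := by
  have hβ0 : 0 < β := by
    by_contra h
    nlinarith
  have hβs : 0 < β - a / s := by
    rw [sub_pos, div_lt_iff₀ hs]; linarith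
  -- The slower of the decay rates on the two sides of the crossing index y. The factor `2 ^ ε` in
  -- the constant pays for rounding y to `⌊y⌋`.
  set ε := min a (s * β - a) with hε
  have hε0 : 0 < ε := lt_min ha (by linarith)
  refine ⟨2 ^ ε * ∑' n : ℤ, (2 : ℝ≥0∞) ^ (-(|(n : ℝ)| * ε)),
    ENNReal.mul_ne_top (two_rpow_ne_top _) (tsum_two_rpow_neg_abs_ne_top hε0), fun Φ => ?_⟩
  rcases eq_or_ne Φ 0 with rfl | h0
  · simp [ENNReal.zero_rpow_of_pos hβ0]
  rcases eq_or_ne Φ ∞ with rfl | ht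
  · rw [ENNReal.top_rpow_of_pos hβs, ENNReal.mul_top]
    · exact le_top
    · refine mul_ne_zero (two_rpow_ne_zero _) fun h => ?_
      exact two_rpow_ne_zero _ (ENNReal.tsum_eq_zero.1 h 0)
  obtain ⟨y, rfl⟩ : ∃ y : ℝ, Φ = 2 ^ (-(y * s)) := by
    have hpos : 0 < Φ.toReal := ENNReal.toReal_pos h0 ht
    refine ⟨-(Real.logb 2 Φ.toReal / s), ?_⟩
    have : -(-(Real.logb 2 Φ.toReal / s) * s) = Real.logb 2 Φ.toReal := by field_simp
    rw [this]
    have h2 : (2 : ℝ≥0∞) = ENNReal.ofReal 2 := by simp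
    rw [h2, ENNReal.ofReal_rpow_of_pos two_pos,
      Real.rpow_logb two_pos (by norm_num) hpos, ENNReal.ofReal_toReal ht]
  have hterm : ∀ k : ℤ, (2 : ℝ≥0∞) ^ (k * a) * (min (2 ^ (-(y * s))) (2 ^ (-(k * s)))) ^ β ≤
      (2 ^ ε * (2 ^ (-(y * s))) ^ (β - a / s)) * 2 ^ (-(|((k - ⌊y⌋ : ℤ) : ℝ)| * ε)) := by
    intro k
    have hmul : -(y * s) * (β - a / s) = -(y * s * β) + y * a := by field_simp; ring
    have habs : |((k - ⌊y⌋ : ℤ) : ℝ)| ≤ |k - y| + 1 := by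
      have h1 := Int.floor_le y
      have h2 := Int.lt_floor_add_one y
      push_cast
      have : (k : ℝ) - ⌊y⌋ = (k - y) + (y - ⌊y⌋) := by ring
      rw [this]
      refine (abs_add_le _ _).trans ?_
      gcongr
      rw [abs_of_nonneg (by linarith)]; linarith
    have hfin : (2 : ℝ≥0∞) ^ (-(y * s * β) + y * a - |k - y| * ε) ≤
        (2 ^ ε * (2 ^ (-(y * s))) ^ (β - a / s)) * 2 ^ (-(|((k - ⌊y⌋ : ℤ) : ℝ)| * ε)) := by
      rw [two_rpow_rpow, two_rpow_mul, two_rpow_mul, hmul]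
      refine two_rpow_le ?_
      nlinarith
    refine le_trans ?_ hfin
    rcases le_total (k : ℝ) y with h | h
    · calc _ ≤ (2 : ℝ≥0∞) ^ (k * a) * (2 ^ (-(y * s))) ^ β := by gcongr; exact min_le_left _ _
        _ ≤ _ := by
          rw [two_rpow_rpow, two_rpow_mul]
          refine two_rpow_le ?_
          rw [abs_of_nonpos (by linarith)]
          nlinarith [min_le_left a (s * β - a)]
    · calc _ ≤ (2 : ℝ≥0∞) ^ (k * a) * (2 ^ (-(k * s))) ^ β := by gcongr; exact min_le_right _ _
        _ ≤ _ := by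
          rw [two_rpow_rpow, two_rpow_mul]
          refine two_rpow_le ?_
          rw [abs_of_nonneg (by linarith)]
          nlinarith [min_le_right a (s * β - a)]
  refine (ENNReal.tsum_le_tsum hterm).trans (le_of_eq ?_)
  rw [ENNReal.tsum_mul_left]
  have : ∑' k : ℤ, (2 : ℝ≥0∞) ^ (-(|((k - ⌊y⌋ : ℤ) : ℝ)| * ε)) =
      ∑' n : ℤ, (2 : ℝ≥0∞) ^ (-(|(n : ℝ)| * ε)) :=
    (Equiv.subRight ⌊y⌋).tsum_eq fun n : ℤ => (2 : ℝ≥0∞) ^ (-(|(n : ℝ)| * ε))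
  rw [this]
  ring

/-! ### Dyadic parabolic balls and averages -/

/-- The parabolic ball of radius `2 ^ k`, symmetric in time. -/
def dyadicBall {d : ℕ} (k : ℤ) (z : SpaceTime d) : Set (SpaceTime d) :=
  Metric.closedBall z.1 (((2 : ℝ) ^ k) ^ 2) ×ˢ Metric.closedBall z.2 ((2 : ℝ) ^ k)

/-- The measure of the parabolic ball of radius `1`. -/
def unitVolume (d : ℕ) : ℝ≥0∞ :=
  2 * volume (Metric.ball (0 : EuclideanSpace ℝ (Fin d)) 1)

/-- The average over a dyadic parabolic ball, up to the factor `unitVolume d`. -/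
def dyadicAvg {d : ℕ} (k : ℤ) (F : SpaceTime d → ℝ≥0∞) (z : SpaceTime d) : ℝ≥0∞ :=
  2 ^ (-(k * ((d : ℝ) + 2))) * ∫⁻ w in dyadicBall k z, F w

section

variable {d : ℕ}

lemma unitVolume_ne_top : unitVolume d ≠ ∞ :=
  ENNReal.mul_ne_top ENNReal.ofNat_ne_top measure_ball_lt_top.ne

lemma unitVolume_ne_zero : unitVolume d ≠ 0 :=
  mul_ne_zero two_ne_zero (Metric.measure_ball_pos _ _ one_pos).ne'

lemma mem_dyadicBall_comm {k : ℤ} {z w : SpaceTime d} :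
    w ∈ dyadicBall k z ↔ z ∈ dyadicBall k w := by
  simp [dyadicBall, Set.mem_prod, dist_comm]

/-- Triangle inequality in each factor; in time, 4^k + 4^j ≤ 4^(j+1). -/
lemma dyadicBall_subset {k j : ℤ} (hkj : k ≤ j) {y z : SpaceTime d} (hy : y ∈ dyadicBall k z) :
    dyadicBall j y ⊆ dyadicBall (j + 1) z := by
  intro w hw
  simp only [dyadicBall, Set.mem_prod, Metric.mem_closedBall] at *
  have h : (2 : ℝ) ^ k ≤ 2 ^ j := zpow_le_zpow_right₀ one_le_two hkj
  have h0 : (0 : ℝ) < 2 ^ k := by positivity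
  have h1 : (2 : ℝ) ^ (j + 1) = 2 * 2 ^ j := by rw [zpow_add_one₀ two_ne_zero]; ring
  rw [h1]
  constructor
  · have := dist_triangle w.1 y.1 z.1
    nlinarith
  · have := dist_triangle w.2 y.2 z.2
    linarith

lemma isClosed_mem_dyadicBall (k : ℤ) :
    IsClosed {p : SpaceTime d × SpaceTime d | p.2 ∈ dyadicBall k p.1} := by
  have : {p : SpaceTime d × SpaceTime d | p.2 ∈ dyadicBall k p.1} =
      {p | dist p.2.1 p.1.1 ≤ ((2 : ℝ) ^ k) ^ 2} ∩ {p | dist p.2.2 p.1.2 ≤ (2 : ℝ) ^ k} := by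
    ext p; simp [dyadicBall, Set.mem_prod]
  rw [this]
  exact (isClosed_le (by fun_prop) (by fun_prop)).inter (isClosed_le (by fun_prop) (by fun_prop))

lemma measurableSet_dyadicBall (k : ℤ) (z : SpaceTime d) : MeasurableSet (dyadicBall k z) :=
  Metric.isClosed_closedBall.measurableSet.prod Metric.isClosed_closedBall.measurableSet

lemma volume_dyadicBall (k : ℤ) (z : SpaceTime d) :
    volume (dyadicBall k z) = unitVolume d * 2 ^ (k * ((d : ℝ) + 2)) := by
  have hk : (0 : ℝ) ≤ 2 ^ k := by positivity
  rw [dyadicBall, Measure.volume_eq_prod, Measure.prod_prod, Real.volume_closedBall,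
    Measure.addHaar_closedBall _ _ hk, unitVolume, finrank_euclideanSpace_fin,
    ENNReal.ofReal_mul two_pos.le, ENNReal.ofReal_pow hk, ENNReal.ofReal_pow hk, ofReal_two_zpow,
    ← ENNReal.rpow_natCast, ← ENNReal.rpow_natCast, two_rpow_rpow, two_rpow_rpow]
  have : (k : ℝ) * (d + 2) = k * (2 : ℕ) + k * d := by push_cast; ring
  rw [this, ← two_rpow_mul]
  simp only [ENNReal.ofReal_ofNat]
  ring

lemma iUnion_dyadicBall (z : SpaceTime d) : (⋃ n : ℕ, dyadicBall n z) = Set.univ := by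
  refine Set.eq_univ_of_forall fun w => Set.mem_iUnion.2 ?_
  obtain ⟨n, hn⟩ :=
    pow_unbounded_of_one_lt (max (dist w.1 z.1) (dist w.2 z.2)) (one_lt_two (α := ℝ))
  obtain ⟨h1, h2⟩ := max_lt_iff.1 hn
  refine ⟨n, ?_, ?_⟩
  · simp only [Metric.mem_closedBall, zpow_natCast]
    have : (1 : ℝ) ≤ 2 ^ n := one_le_pow₀ one_le_two
    refine h1.le.trans ?_
    nlinarith
  · simpa only [Metric.mem_closedBall, zpow_natCast] using h2.le

lemma dyadicAvg_le_of_mem {k j : ℤ} (hkj : k ≤ j) (F : SpaceTime d → ℝ≥0∞) {y z : SpaceTime d}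
    (hy : y ∈ dyadicBall k z) :
    dyadicAvg j F y ≤ 2 ^ ((d : ℝ) + 2) * dyadicAvg (j + 1) F z := by
  rw [dyadicAvg, dyadicAvg, ← mul_assoc, two_rpow_mul]
  refine mul_le_mul' (two_rpow_le ?_) (lintegral_mono_set (dyadicBall_subset hkj hy))
  push_cast; linarith

lemma dyadicAvg_mono {k : ℤ} {F G : SpaceTime d → ℝ≥0∞} {z : SpaceTime d}
    (h : ∀ y ∈ dyadicBall k z, F y ≤ G y) : dyadicAvg k F z ≤ dyadicAvg k G z := by
  rw [dyadicAvg, dyadicAvg]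
  gcongr 2 ^ _ * ?_
  exact setLIntegral_mono' (measurableSet_dyadicBall k z) h

lemma dyadicAvg_const (k : ℤ) (c : ℝ≥0∞) (z : SpaceTime d) :
    dyadicAvg k (fun _ => c) z = c * unitVolume d := by
  rw [dyadicAvg, setLIntegral_const, volume_dyadicBall]
  have h : (2 : ℝ≥0∞) ^ (-(k * ((d : ℝ) + 2))) * 2 ^ (k * ((d : ℝ) + 2)) = 1 := by
    rw [two_rpow_mul]; simp
  calc _ = c * unitVolume d * ((2 : ℝ≥0∞) ^ (-(k * ((d : ℝ) + 2))) * 2 ^ (k * ((d : ℝ) + 2))) := by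
        ring
    _ = _ := by rw [h, mul_one]

lemma dyadicAvg_const_mul (k : ℤ) (c : ℝ≥0∞) {F : SpaceTime d → ℝ≥0∞} (hF : Measurable F)
    (z : SpaceTime d) : dyadicAvg k (fun y => c * F y) z = c * dyadicAvg k F z := by
  rw [dyadicAvg, lintegral_const_mul _ hF, dyadicAvg]
  ring

lemma setLIntegral_dyadicBall_eq (k : ℤ) (F : SpaceTime d → ℝ≥0∞) (z : SpaceTime d) :
    ∫⁻ w in dyadicBall k z, F w = ∫⁻ w, (dyadicBall k z).indicator F w :=
  (lintegral_indicator (measurableSet_dyadicBall k z) F).symm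

lemma measurable_uncurry_indicator_dyadicBall (k : ℤ) {F : SpaceTime d → ℝ≥0∞}
    (hF : Measurable F) :
    Measurable (Function.uncurry fun z w : SpaceTime d => (dyadicBall k z).indicator F w) :=
  (hF.comp measurable_snd).indicator (isClosed_mem_dyadicBall k).measurableSet

lemma measurable_dyadicAvg (k : ℤ) {F : SpaceTime d → ℝ≥0∞} (hF : Measurable F) :
    Measurable (dyadicAvg k F) := by
  refine Measurable.const_mul ?_ _
  simp_rw [setLIntegral_dyadicBall_eq]
  exact (measurable_uncurry_indicator_dyadicBall k hF).lintegral_prod_right'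

/-- Tonelli: each w is counted for a set of centres y of measure at most |Bⱼ|, and only if w lies in
the doubled ball. -/
lemma dyadicAvg_dyadicAvg_le {j k : ℤ} (hjk : j ≤ k) {F : SpaceTime d → ℝ≥0∞} (hF : Measurable F)
    (z : SpaceTime d) :
    dyadicAvg k (dyadicAvg j F) z ≤
      unitVolume d * 2 ^ ((d : ℝ) + 2) * dyadicAvg (k + 1) F z := by
  have hswap : ∫⁻ y in dyadicBall k z, ∫⁻ w in dyadicBall j y, F w ≤
      ∫⁻ w in dyadicBall (k + 1) z, F w * (unitVolume d * 2 ^ (j * ((d : ℝ) + 2))) := by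
    simp_rw [setLIntegral_dyadicBall_eq j F]
    rw [lintegral_lintegral_swap (measurable_uncurry_indicator_dyadicBall j hF).aemeasurable,
      ← lintegral_indicator (measurableSet_dyadicBall _ z)]
    refine lintegral_mono fun w => ?_
    by_cases hw : w ∈ dyadicBall (k + 1) z
    · rw [Set.indicator_of_mem hw]
      calc _ ≤ ∫⁻ y, (dyadicBall j y).indicator F w := setLIntegral_le_lintegral _ _
        _ = ∫⁻ y, (dyadicBall j w).indicator (fun _ => F w) y := by
          refine lintegral_congr fun y => ?_
          by_cases h : w ∈ dyadicBall j y
          · rw [Set.indicator_of_mem h, Set.indicator_of_mem (mem_dyadicBall_comm.1 h)]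
          · rw [Set.indicator_of_notMem h,
              Set.indicator_of_notMem fun h' => h (mem_dyadicBall_comm.1 h')]
        _ = _ := by
          rw [lintegral_indicator (measurableSet_dyadicBall _ _), setLIntegral_const,
            volume_dyadicBall]
    · refine le_of_eq_of_le (setLIntegral_eq_zero (measurableSet_dyadicBall k z) fun y hy => ?_)
        zero_le
      have hsub : dyadicBall j y ⊆ dyadicBall k y := by
        have h : (2 : ℝ) ^ j ≤ 2 ^ k := zpow_le_zpow_right₀ one_le_two hjk
        exact Set.prod_mono (Metric.closedBall_subset_closedBall (by gcongr))
          (Metric.closedBall_subset_closedBall h)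
      exact Set.indicator_of_notMem (fun h => hw (dyadicBall_subset le_rfl hy (hsub h))) _
  have hm : Measurable fun y => ∫⁻ w in dyadicBall j y, F w := by
    simp_rw [setLIntegral_dyadicBall_eq]
    exact (measurable_uncurry_indicator_dyadicBall j hF).lintegral_prod_right'
  simp only [dyadicAvg]
  rw [lintegral_const_mul _ hm]
  calc _ ≤ (2 : ℝ≥0∞) ^ (-(k * ((d : ℝ) + 2))) * (2 ^ (-(j * ((d : ℝ) + 2))) *
        ∫⁻ w in dyadicBall (k + 1) z, F w * (unitVolume d * 2 ^ (j * ((d : ℝ) + 2)))) := by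
        gcongr
    _ = unitVolume d * ((2 : ℝ≥0∞) ^ (-(j * ((d : ℝ) + 2))) * 2 ^ (j * ((d : ℝ) + 2))) *
        2 ^ (-(k * ((d : ℝ) + 2))) * ∫⁻ w in dyadicBall (k + 1) z, F w := by
        rw [lintegral_mul_const _ hF]; ring
    _ = _ := by
        have : -((k : ℝ) * (d + 2)) = (d + 2) + -(((k + 1 : ℤ) : ℝ) * (d + 2)) := by
          push_cast; ring
        rw [two_rpow_mul, neg_add_cancel, ENNReal.rpow_zero, this, ← two_rpow_mul]
        ring

lemma dyadicAvg_rpow_mul_rpow_le (k : ℤ) {F G : SpaceTime d → ℝ≥0∞} (hF : Measurable F)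
    (hG : Measurable G) {θ θ' : ℝ} (hθ : 0 ≤ θ) (hθ' : 0 ≤ θ') (h : θ + θ' = 1)
    (z : SpaceTime d) :
    dyadicAvg k (fun y => F y ^ θ * G y ^ θ') z ≤ dyadicAvg k F z ^ θ * dyadicAvg k G z ^ θ' := by
  rw [dyadicAvg, dyadicAvg, dyadicAvg, ENNReal.mul_rpow_of_nonneg _ _ hθ,
    ENNReal.mul_rpow_of_nonneg _ _ hθ', two_rpow_rpow, two_rpow_rpow]
  calc _ ≤ (2 : ℝ≥0∞) ^ (-(k * ((d : ℝ) + 2))) *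
        ((∫⁻ w in dyadicBall k z, F w) ^ θ * (∫⁻ w in dyadicBall k z, G w) ^ θ') := by
        gcongr
        exact ENNReal.lintegral_mul_norm_pow_le hF.aemeasurable hG.aemeasurable hθ hθ' h
    _ = _ := by
        have : -((k : ℝ) * (d + 2)) = -(k * (d + 2)) * θ + -(k * (d + 2)) * θ' := by
          rw [← mul_add, h, mul_one]
        nth_rewrite 1 [this]
        rw [← two_rpow_mul]
        ring

/-- Jensen's inequality, as Hölder against the constant 1, whose `dyadicAvg` is `unitVolume d`. -/
lemma dyadicAvg_rpow_le (k : ℤ) {G : SpaceTime d → ℝ≥0∞} (hG : Measurable G) {θ : ℝ}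
    (hθ : 0 ≤ θ) (hθ1 : θ ≤ 1) (z : SpaceTime d) :
    dyadicAvg k (fun y => G y ^ θ) z ≤ dyadicAvg k G z ^ θ * unitVolume d ^ (1 - θ) := by
  have := dyadicAvg_rpow_mul_rpow_le k hG (measurable_const (a := (1 : ℝ≥0∞))) hθ
    (sub_nonneg.2 hθ1) (by ring) z
  simpa [dyadicAvg_const] using this

end

/-! ### The fractional maximal function -/

/-- The dyadic fractional maximal function over radii at least `2 ^ k`. -/
def fracMaxFrom {d : ℕ} (η : ℝ) (F : SpaceTime d → ℝ≥0∞) (k : ℤ) (z : SpaceTime d) : ℝ≥0∞ :=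
  ⨆ (j : ℤ) (_ : k ≤ j), 2 ^ (j * η) * dyadicAvg j F z

/-- The dyadic fractional maximal function. -/
def fracMax {d : ℕ} (η : ℝ) (F : SpaceTime d → ℝ≥0∞) (z : SpaceTime d) : ℝ≥0∞ :=
  ⨆ j : ℤ, 2 ^ (j * η) * dyadicAvg j F z

section

variable {d : ℕ}

lemma fracMaxFrom_le_fracMax (η : ℝ) (F : SpaceTime d → ℝ≥0∞) (k : ℤ) (z : SpaceTime d) :
    fracMaxFrom η F k z ≤ fracMax η F z :=
  iSup_mono fun _ => iSup_le fun _ => le_rfl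

lemma le_fracMaxFrom (η : ℝ) (F : SpaceTime d → ℝ≥0∞) {k j : ℤ} (h : k ≤ j) (z : SpaceTime d) :
    2 ^ (j * η) * dyadicAvg j F z ≤ fracMaxFrom η F k z :=
  le_iSup₂_of_le (f := fun (j : ℤ) (_ : k ≤ j) => 2 ^ (j * η) * dyadicAvg j F z) j h le_rfl

lemma measurable_fracMax (η : ℝ) {F : SpaceTime d → ℝ≥0∞} (hF : Measurable F) :
    Measurable (fracMax η F) :=
  Measurable.iSup fun j => (measurable_dyadicAvg j hF).const_mul _

/-- The second bound holds because 2^(jη) 2^(-jq) is nonincreasing in j, so the smallest admissible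
radius is the worst. -/
lemma fracMaxFrom_le {η q : ℝ} (hη : η ≤ q) {F : SpaceTime d → ℝ≥0∞}
    (hF : ∀ (k : ℤ) (z : SpaceTime d), dyadicAvg k F z ≤ 2 ^ (-(k * q))) (k : ℤ)
    (z : SpaceTime d) : fracMaxFrom η F k z ≤ min (fracMax η F z) (2 ^ (-(k * (q - η)))) := by
  refine le_min (fracMaxFrom_le_fracMax η F k z) (iSup₂_le fun j hj => ?_)
  refine (mul_le_mul_right (hF j z) _).trans ?_
  rw [two_rpow_mul]
  refine two_rpow_le ?_
  have : (k : ℝ) ≤ j := by exact_mod_cast hj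
  nlinarith

/-- Powers at most `1` of the fractional maximal function average like Muckenhoupt `A₁`
weights. -/
lemma exists_dyadicAvg_fracMax_rpow_le (d : ℕ) {η γ : ℝ} (hη : 0 < η) (hγ : 0 < γ) (hγ1 : γ ≤ 1) :
    ∃ C : ℝ≥0∞, C ≠ ∞ ∧ ∀ F : SpaceTime d → ℝ≥0∞, Measurable F → ∀ (k : ℤ) (z : SpaceTime d),
      dyadicAvg k (fun y => fracMax η F y ^ γ) z ≤ C * fracMaxFrom η F k z ^ γ := by
  set D : ℝ := (d : ℝ) + 2
  set A : ℝ≥0∞ := (unitVolume d * 2 ^ D) ^ γ * unitVolume d ^ (1 - γ) with hA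
  have hAt : A ≠ ∞ := ENNReal.mul_ne_top
    (ENNReal.rpow_ne_top_of_nonneg hγ.le
      (ENNReal.mul_ne_top unitVolume_ne_top (two_rpow_ne_top _)))
    (ENNReal.rpow_ne_top_of_nonneg (by linarith) unitVolume_ne_top)
  refine ⟨A * ∑' n : ℕ, (2 : ℝ≥0∞) ^ (-(n * (η * γ))) + 2 ^ (D * γ) * unitVolume d,
    ENNReal.add_ne_top.2 ⟨ENNReal.mul_ne_top hAt (tsum_two_rpow_neg_nat_ne_top (by positivity)),
      ENNReal.mul_ne_top (two_rpow_ne_top _) unitVolume_ne_top⟩, fun F hF k z => ?_⟩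
  set Ψ := fracMaxFrom η F k z with hΨ
  have hmeas : ∀ n : ℕ, Measurable fun y : SpaceTime d =>
      (2 : ℝ≥0∞) ^ (((k - n : ℤ) : ℝ) * η * γ) * dyadicAvg (k - n) F y ^ γ := fun n =>
    ((measurable_dyadicAvg _ hF).pow_const _).const_mul _
  -- Split the supremum at radius 2^k. Smaller radii are bounded by a sum, to be averaged term by
  -- term; larger balls are recentred at z after doubling.
  have hpt : ∀ y ∈ dyadicBall k z, fracMax η F y ^ γ ≤
      (∑' n : ℕ, (2 : ℝ≥0∞) ^ (((k - n : ℤ) : ℝ) * η * γ) * dyadicAvg (k - n) F y ^ γ) +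
        2 ^ (D * γ) * Ψ ^ γ := by
    intro y hy
    rw [← ENNReal.le_rpow_inv_iff hγ]
    refine iSup_le fun j => ?_
    rw [ENNReal.le_rpow_inv_iff hγ]
    rcases le_total j k with hj | hj
    · obtain ⟨n, hn⟩ := Int.eq_ofNat_of_zero_le (sub_nonneg.2 hj)
      obtain rfl : j = k - n := by omega
      refine le_add_right (le_trans (le_of_eq ?_) (ENNReal.le_tsum n))
      rw [ENNReal.mul_rpow_of_nonneg _ _ hγ.le, two_rpow_rpow]
    · refine le_add_left ?_
      rw [← two_rpow_rpow D, ← ENNReal.mul_rpow_of_nonneg _ _ hγ.le]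
      refine ENNReal.rpow_le_rpow ?_ hγ.le
      calc 2 ^ ((j : ℝ) * η) * dyadicAvg j F y
          ≤ 2 ^ (((j + 1 : ℤ) : ℝ) * η) * (2 ^ D * dyadicAvg (j + 1) F z) := by
            refine mul_le_mul' (two_rpow_le ?_) (dyadicAvg_le_of_mem hj F hy)
            push_cast; nlinarith
        _ = 2 ^ D * (2 ^ (((j + 1 : ℤ) : ℝ) * η) * dyadicAvg (j + 1) F z) := by ring
        _ ≤ 2 ^ D * Ψ := by gcongr; exact le_fracMaxFrom η F (by omega) z
  -- The weight 2^(jη) with j = k - n yields the decay 2^(-nηγ). Since η > 0 this is summable even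
  -- at γ = 1.
  have hterm : ∀ n : ℕ, dyadicAvg k (fun y =>
      (2 : ℝ≥0∞) ^ (((k - n : ℤ) : ℝ) * η * γ) * dyadicAvg (k - n) F y ^ γ) z ≤
        A * Ψ ^ γ * 2 ^ (-(n * (η * γ))) := by
    intro n
    rw [dyadicAvg_const_mul _ _ ((measurable_dyadicAvg _ hF).pow_const _)]
    calc _ ≤ (2 : ℝ≥0∞) ^ (((k - n : ℤ) : ℝ) * η * γ) *
          ((unitVolume d * 2 ^ D * dyadicAvg (k + 1) F z) ^ γ * unitVolume d ^ (1 - γ)) := by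
          gcongr
          refine (dyadicAvg_rpow_le k (measurable_dyadicAvg _ hF) hγ.le hγ1 z).trans ?_
          gcongr
          exact dyadicAvg_dyadicAvg_le (by omega) hF z
      _ = A * (2 ^ (k * η) * dyadicAvg (k + 1) F z) ^ γ * 2 ^ (-(n * (η * γ))) := by
          rw [ENNReal.mul_rpow_of_nonneg (_ * _) _ hγ.le,
            ENNReal.mul_rpow_of_nonneg (2 ^ (k * η)) _ hγ.le, two_rpow_rpow (k * η), hA]
          have : ((k - n : ℤ) : ℝ) * η * γ = k * η * γ + -(n * (η * γ)) := by push_cast; ring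
          rw [this, ← two_rpow_mul]
          ring
      _ ≤ _ := by
          gcongr
          refine le_trans ?_ (le_fracMaxFrom η F (by omega : k ≤ k + 1) z)
          gcongr
          · exact one_le_two
          · linarith
  refine (dyadicAvg_mono hpt).trans ?_
  have hsplit : dyadicAvg k (fun y =>
      (∑' n : ℕ, (2 : ℝ≥0∞) ^ (((k - n : ℤ) : ℝ) * η * γ) * dyadicAvg (k - n) F y ^ γ) +
        2 ^ (D * γ) * Ψ ^ γ) z =
      (∑' n : ℕ, dyadicAvg k (fun y =>
        (2 : ℝ≥0∞) ^ (((k - n : ℤ) : ℝ) * η * γ) * dyadicAvg (k - n) F y ^ γ) z) +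
        2 ^ (D * γ) * Ψ ^ γ * unitVolume d := by
    rw [← dyadicAvg_const k]
    simp only [dyadicAvg]
    rw [lintegral_add_right _ measurable_const, mul_add, ENNReal.tsum_mul_left]
    congr 2
    exact lintegral_tsum fun n => (hmeas n).aemeasurable
  rw [hsplit]
  calc _ ≤ (∑' n : ℕ, A * Ψ ^ γ * 2 ^ (-(n * (η * γ)))) + 2 ^ (D * γ) * Ψ ^ γ * unitVolume d := by
        gcongr with n
        exact hterm n
    _ = _ := by rw [ENNReal.tsum_mul_left]; ring

/-- The A₁-type bound with γ = 1, together with the Morrey bound, makes the maximal function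
integrable on every ball. -/
lemma fracMax_ae_lt_top {η q : ℝ} (hη : 0 < η) (hq : η ≤ q) {F : SpaceTime d → ℝ≥0∞}
    (hF : Measurable F)
    (hM : ∀ (k : ℤ) (z : SpaceTime d), dyadicAvg k F z ≤ 2 ^ (-(k * q))) :
    ∀ᵐ z, fracMax η F z < ∞ := by
  obtain ⟨C, hC, h⟩ := exists_dyadicAvg_fracMax_rpow_le d hη one_pos le_rfl
  have hk : ∀ n : ℕ, ∀ᵐ z ∂(volume.restrict (dyadicBall n (0 : SpaceTime d))),
      fracMax η F z < ∞ := by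
    intro n
    refine ae_lt_top (measurable_fracMax η hF) fun htop => ?_
    have h1 := (h F hF n 0).trans (mul_le_mul_right (ENNReal.rpow_le_rpow
      ((fracMaxFrom_le hq hM n 0).trans (min_le_right _ _)) zero_le_one) C)
    simp only [ENNReal.rpow_one, dyadicAvg, htop] at h1
    rw [ENNReal.mul_top (two_rpow_ne_zero _), top_le_iff] at h1
    exact ENNReal.mul_ne_top hC (two_rpow_ne_top _) h1
  rw [← Measure.restrict_univ (μ := (volume : Measure (SpaceTime d))), ← iUnion_dyadicBall 0,
    ae_restrict_iUnion_iff]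
  exact hk

lemma ae_eq_zero_of_fracMax_eq_zero {η : ℝ} {F : SpaceTime d → ℝ≥0∞} (hF : Measurable F)
    {z : SpaceTime d} (h : fracMax η F z = 0) : F =ᵐ[volume] 0 := by
  have hk : ∀ k : ℤ, ∫⁻ w in dyadicBall k z, F w = 0 := by
    intro k
    have h1 := (ENNReal.iSup_eq_zero.1 h) k
    rw [dyadicAvg] at h1
    simpa [two_rpow_ne_zero] using h1
  change ∀ᵐ w, F w = 0
  rw [← Measure.restrict_univ (μ := (volume : Measure (SpaceTime d))), ← iUnion_dyadicBall z,
    ae_restrict_iUnion_iff]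
  intro n
  exact (lintegral_eq_zero_iff hF).1 (hk n)

end

/-! ### Schur test -/

/-- Weighted Schur test for a nonnegative kernel, with test functions `u` and `v`. -/
lemma lintegral_mul_rpow_lintegral_le {X : Type*} [MeasurableSpace X] {μ : Measure X} [SFinite μ]
    {κ : X → X → ℝ≥0∞} (hκ : Measurable (Function.uncurry κ)) {V u v : X → ℝ≥0∞}
    (hV : Measurable V) (hu : Measurable u) (hv : Measurable v) {p : ℝ} (hp : 1 < p)
    (hu0 : ∀ᵐ w ∂μ, u w ≠ 0) (hut : ∀ᵐ w ∂μ, u w ≠ ∞) {C : ℝ≥0∞}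
    (huv : ∀ z, ∫⁻ w, κ z w * u w ∂μ ≤ v z)
    (hvu : ∀ w, ∫⁻ z, κ z w * (V z * v z ^ (p - 1)) ∂μ ≤ C * u w ^ (p - 1))
    {f : X → ℝ≥0∞} (hf : Measurable f) :
    ∫⁻ z, V z * (∫⁻ w, κ z w * f w ∂μ) ^ p ∂μ ≤ C * ∫⁻ w, f w ^ p ∂μ := by
  have hp0 : 0 < p := by linarith
  set h : X → ℝ≥0∞ := fun w => u w ^ (1 - p) * f w ^ p with hh
  have hhm : Measurable h := (hu.pow_const _).mul (hf.pow_const _)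
  have hκz : ∀ z, Measurable (κ z) := fun z => hκ.comp measurable_prodMk_left
  have hpt : ∀ z, (∫⁻ w, κ z w * f w ∂μ) ^ p ≤ v z ^ (p - 1) * ∫⁻ w, κ z w * h w ∂μ := by
    intro z
    -- Preparation for Hölder with exponents p/(p-1) and p. The powers of u cancel only where u is
    -- neither 0 nor ∞, hence the almost everywhere argument.
    have h1 : ∫⁻ w, κ z w * f w ∂μ =
        ∫⁻ w, (κ z w * u w) ^ (1 - 1 / p) * (κ z w * h w) ^ (1 / p) ∂μ := by
      refine lintegral_congr_ae ?_
      filter_upwards [hu0, hut] with w h0 ht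
      have hp1 : 0 ≤ 1 - 1 / p := by
        rw [sub_nonneg, div_le_one hp0]; exact hp.le
      rw [ENNReal.mul_rpow_of_nonneg _ _ hp1, hh,
        ENNReal.mul_rpow_of_nonneg _ _ (by positivity : 0 ≤ 1 / p),
        ENNReal.mul_rpow_of_nonneg _ _ (by positivity : 0 ≤ 1 / p),
        ← ENNReal.rpow_mul, ← ENNReal.rpow_mul, mul_one_div_cancel hp0.ne', ENNReal.rpow_one]
      have h2 : κ z w ^ (1 - 1 / p) * κ z w ^ (1 / p) = κ z w := by
        rw [← ENNReal.rpow_add_of_nonneg _ _ hp1 (by positivity)]; simp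
      have h3 : u w ^ (1 - 1 / p) * u w ^ ((1 - p) * (1 / p)) = 1 := by
        rw [← ENNReal.rpow_add _ _ h0 ht]
        have : 1 - 1 / p + (1 - p) * (1 / p) = 0 := by field_simp; ring
        rw [this, ENNReal.rpow_zero]
      calc κ z w * f w = (κ z w ^ (1 - 1 / p) * κ z w ^ (1 / p)) *
            (u w ^ (1 - 1 / p) * u w ^ ((1 - p) * (1 / p))) * f w := by rw [h2, h3, mul_one]
        _ = _ := by ring
    have hp1 : 0 ≤ 1 - 1 / p := by
      rw [sub_nonneg, div_le_one hp0]; exact hp.le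
    rw [h1]
    calc _ ≤ ((∫⁻ w, κ z w * u w ∂μ) ^ (1 - 1 / p) * (∫⁻ w, κ z w * h w ∂μ) ^ (1 / p)) ^ p := by
          gcongr
          exact ENNReal.lintegral_mul_norm_pow_le ((hκz z).mul hu).aemeasurable
            ((hκz z).mul hhm).aemeasurable hp1 (by positivity) (by ring)
      _ = (∫⁻ w, κ z w * u w ∂μ) ^ (p - 1) * ∫⁻ w, κ z w * h w ∂μ := by
          rw [ENNReal.mul_rpow_of_nonneg _ _ hp0.le, ← ENNReal.rpow_mul, ← ENNReal.rpow_mul,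
            one_div_mul_cancel hp0.ne', ENNReal.rpow_one]
          congr 2
          field_simp
      _ ≤ _ := by
          exact mul_le_mul_left (ENNReal.rpow_le_rpow (huv z) (by linarith)) _
  calc _ ≤ ∫⁻ z, V z * (v z ^ (p - 1) * ∫⁻ w, κ z w * h w ∂μ) ∂μ := by
        gcongr with z
        exact hpt z
    _ = ∫⁻ z, ∫⁻ w, h w * (κ z w * (V z * v z ^ (p - 1))) ∂μ ∂μ := by
        refine lintegral_congr fun z => ?_
        rw [← mul_assoc, ← lintegral_const_mul _ ((hκz z).fun_mul hhm)]
        refine lintegral_congr fun w => ?_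
        ring
    _ = ∫⁻ w, h w * ∫⁻ z, κ z w * (V z * v z ^ (p - 1)) ∂μ ∂μ := by
        rw [lintegral_lintegral_swap]
        · refine lintegral_congr fun w => lintegral_const_mul _ ?_
          exact (hκ.comp measurable_prodMk_right).mul (hV.mul (hv.pow_const _))
        · exact ((hhm.comp measurable_snd).mul (hκ.mul
            ((hV.mul (hv.pow_const _)).comp measurable_fst))).aemeasurable
    _ ≤ ∫⁻ w, h w * (C * u w ^ (p - 1)) ∂μ := by
        gcongr with w
        exact hvu w
    _ = ∫⁻ w, C * f w ^ p ∂μ := by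
        refine lintegral_congr_ae ?_
        filter_upwards [hu0, hut] with w h0 ht
        have h3 : u w ^ (1 - p) * u w ^ (p - 1) = 1 := by
          rw [← ENNReal.rpow_add _ _ h0 ht]; simp
        calc _ = C * (u w ^ (1 - p) * u w ^ (p - 1)) * f w ^ p := by rw [hh]; ring
          _ = _ := by rw [h3, mul_one]
    _ = _ := lintegral_const_mul _ (hf.pow_const _)

/-! ### The dyadic potential -/

/-- A symmetric dyadic model of the parabolic Riesz kernel of order `α`. -/
def dyadicKernel {d : ℕ} (α : ℝ) (z w : SpaceTime d) : ℝ≥0∞ :=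
  ∑' k : ℤ, 2 ^ (k * (α - ((d : ℝ) + 2))) * (dyadicBall k z).indicator 1 w

/-- The potential of order `α` with kernel `dyadicKernel α`. -/
def dyadicPotential {d : ℕ} (α : ℝ) (f : SpaceTime d → ℝ≥0∞) (z : SpaceTime d) : ℝ≥0∞ :=
  ∫⁻ w, dyadicKernel α z w * f w

section

variable {d : ℕ}

lemma measurable_uncurry_dyadicKernel (α : ℝ) :
    Measurable (Function.uncurry (dyadicKernel (d := d) α)) := by
  refine Measurable.tsum fun k => Measurable.const_mul ?_ _
  exact measurable_uncurry_indicator_dyadicBall k (F := 1) measurable_one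

lemma measurable_dyadicKernel (α : ℝ) (z : SpaceTime d) : Measurable (dyadicKernel α z) :=
  (measurable_uncurry_dyadicKernel α).of_uncurry_left

lemma dyadicKernel_comm (α : ℝ) (z w : SpaceTime d) :
    dyadicKernel α z w = dyadicKernel α w z := by
  refine tsum_congr fun k => ?_
  congr 1
  by_cases h : w ∈ dyadicBall k z
  · rw [Set.indicator_of_mem h, Set.indicator_of_mem (mem_dyadicBall_comm.1 h)]
    rfl
  · rw [Set.indicator_of_notMem h, Set.indicator_of_notMem fun h' => h (mem_dyadicBall_comm.1 h')]

lemma dyadicPotential_eq_tsum (α : ℝ) {f : SpaceTime d → ℝ≥0∞} (hf : Measurable f)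
    (z : SpaceTime d) :
    dyadicPotential α f z = ∑' k : ℤ, 2 ^ (k * α) * dyadicAvg k f z := by
  simp only [dyadicPotential, dyadicKernel, ← ENNReal.tsum_mul_right]
  have hm : ∀ k : ℤ, Measurable fun w => (dyadicBall k z).indicator (1 : SpaceTime d → ℝ≥0∞) w :=
    fun k => measurable_one.indicator (measurableSet_dyadicBall k z)
  rw [lintegral_tsum fun k => (((hm k).const_mul _).fun_mul hf).aemeasurable]
  refine tsum_congr fun k => ?_
  have : (k : ℝ) * (α - (d + 2)) = k * α + -(k * (d + 2)) := by ring
  rw [dyadicAvg, ← mul_assoc, two_rpow_mul, this, setLIntegral_dyadicBall_eq,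
    ← lintegral_const_mul _ (hf.indicator (measurableSet_dyadicBall k z))]
  refine lintegral_congr fun w => ?_
  by_cases h : w ∈ dyadicBall k z <;> simp [h]

lemma measurable_dyadicPotential (α : ℝ) {f : SpaceTime d → ℝ≥0∞} (hf : Measurable f) :
    Measurable (dyadicPotential α f) :=
  Measurable.lintegral_prod_right'
    (f := fun x : SpaceTime d × SpaceTime d => dyadicKernel α x.1 x.2 * f x.2)
    ((measurable_uncurry_dyadicKernel α).mul (hf.comp measurable_snd))

/-- Hölder with exponents q and q/(q-1). The factor avg(V^q) is controlled by the term j = k of the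
supremum, the other one by the A₁-type bound `hC`. -/
lemma dyadicAvg_mul_fracMax_rpow_le {q η τ : ℝ} (hq : 1 < q) (hτ : 0 < τ)
    {C : ℝ≥0∞} {V : SpaceTime d → ℝ≥0∞} (hV : Measurable V) (k : ℤ) (z : SpaceTime d)
    (hC : dyadicAvg k (fun y => fracMax η (fun w => V w ^ q) y ^ (τ / (1 - 1 / q))) z ≤
      C * fracMaxFrom η (fun w => V w ^ q) k z ^ (τ / (1 - 1 / q))) :
    dyadicAvg k (fun y => V y * fracMax η (fun w => V w ^ q) y ^ τ) z ≤
      C ^ (1 - 1 / q) * (2 ^ (-(k * (η / q))) *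
        fracMaxFrom η (fun w => V w ^ q) k z ^ (τ + 1 / q)) := by
  have hq0 : 0 < q := by linarith
  have hq1 : 0 < 1 - 1 / q := by
    rw [sub_pos, div_lt_one hq0]; exact hq
  set F : SpaceTime d → ℝ≥0∞ := fun w => V w ^ q with hF
  have hFm : Measurable F := hV.pow_const q
  set Ψ := fracMaxFrom η F k z with hΨ
  have hrw : (fun y => V y * fracMax η F y ^ τ) =
      fun y => F y ^ (1 / q) * (fracMax η F y ^ (τ / (1 - 1 / q))) ^ (1 - 1 / q) := by
    funext y
    rw [hF, ← ENNReal.rpow_mul, ← ENNReal.rpow_mul, mul_one_div_cancel hq0.ne', ENNReal.rpow_one,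
      div_mul_cancel₀ _ hq1.ne']
  have hA : dyadicAvg k F z ≤ 2 ^ (-(k * η)) * Ψ := by
    calc dyadicAvg k F z = 2 ^ (-(k * η)) * (2 ^ (k * η) * dyadicAvg k F z) := by
          rw [← mul_assoc, two_rpow_mul, neg_add_cancel, ENNReal.rpow_zero, one_mul]
      _ ≤ _ := by gcongr; exact le_fracMaxFrom η F le_rfl z
  rw [hrw]
  calc _ ≤ dyadicAvg k F z ^ (1 / q) *
        dyadicAvg k (fun y => fracMax η F y ^ (τ / (1 - 1 / q))) z ^ (1 - 1 / q) :=
        dyadicAvg_rpow_mul_rpow_le k hFm ((measurable_fracMax η hFm).pow_const _) (by positivity)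
          hq1.le (by ring) z
    _ ≤ (2 ^ (-(k * η)) * Ψ) ^ (1 / q) * (C * Ψ ^ (τ / (1 - 1 / q))) ^ (1 - 1 / q) := by
        gcongr
    _ = _ := by
        rw [ENNReal.mul_rpow_of_nonneg _ _ (by positivity : 0 ≤ 1 / q),
          ENNReal.mul_rpow_of_nonneg _ _ hq1.le, two_rpow_rpow, ← ENNReal.rpow_mul,
          div_mul_cancel₀ _ hq1.ne', ENNReal.rpow_add_of_nonneg _ _ hτ.le (by positivity)]
        have : -((k : ℝ) * η) * (1 / q) = -(k * (η / q)) := by ring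
        rw [this]
        ring

/-- The trace inequality for the dyadic potential, for a weight of Morrey norm at most `1`. -/
lemma exists_lintegral_mul_dyadicPotential_rpow_le_of_normalized (d : ℕ) {p q : ℝ} (hp : 1 < p)
    (hq : 1 < q) :
    ∃ C : ℝ≥0∞, C ≠ ∞ ∧ ∀ V : SpaceTime d → ℝ≥0∞, Measurable V →
      (∀ (k : ℤ) (z : SpaceTime d), dyadicAvg k (fun w => V w ^ q) z ≤ 2 ^ (-(k * q))) →
      ∀ f : SpaceTime d → ℝ≥0∞, Measurable f →
        ∫⁻ z, V z * dyadicPotential (1 / p) f z ^ p ≤ C * ∫⁻ w, f w ^ p := by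
  have hp0 : 0 < p := by linarith
  have hp1 : 0 < p - 1 := by linarith
  have hq0 : 0 < q := by linarith
  have hq1 : 0 < 1 - 1 / q := by
    rw [sub_pos, div_lt_one hq0]; exact hq
  set α := 1 / p with hα
  have hα0 : 0 < α := by positivity
  have hα1 : α < 1 := by rw [hα, div_lt_one hp0]; exact hp
  -- η < q - 1 makes s > 1 > α; η < αq keeps the growth rate α - η/q of the dual series positive.
  obtain ⟨η, hη0, hη1, hη2⟩ : ∃ η : ℝ, 0 < η ∧ η < q - 1 ∧ η < α * q := by
    obtain ⟨η, h0, h1⟩ := exists_between (lt_min (sub_pos.2 hq) (mul_pos hα0 hq0))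
    exact ⟨η, h0, h1.trans_le (min_le_left _ _), h1.trans_le (min_le_right _ _)⟩
  set s := q - η with hs
  have hs1 : 1 < s := by linarith
  have hs0 : 0 < s := by linarith
  have hαs : α / s < 1 := by rw [div_lt_one hs0]; linarith
  -- The two upper bounds keep γ and τ/(1 - 1/q) at most 1, as the A₁-type bound requires of both
  -- powers of Φ.
  obtain ⟨δ, hδ0, hδ1, hδ2⟩ : ∃ δ : ℝ, 0 < δ ∧ δ < 1 - α / s ∧ δ < (1 - 1 / q) / (p - 1) := by
    obtain ⟨δ, h0, h1⟩ := exists_between (lt_min (sub_pos.2 hαs) (div_pos hq1 hp1))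
    exact ⟨δ, h0, h1.trans_le (min_le_left _ _), h1.trans_le (min_le_right _ _)⟩
  set γ := α / s + δ with hγ
  have hγ0 : 0 < γ := by positivity
  have hγs : s * γ = α + s * δ := by rw [hγ, mul_add, mul_div_cancel₀ _ hs0.ne']
  set τ := δ * (p - 1) with hτ
  have hτ0 : 0 < τ := by positivity
  have hτ1 : τ / (1 - 1 / q) ≤ 1 := by
    rw [div_le_one hq1]
    rw [lt_div_iff₀ hp1] at hδ2
    exact hδ2.le
  have hαη : 0 < α - η / q := by
    rw [sub_pos, div_lt_iff₀ hq0]; exact hη2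
  have hsq : s * (1 / q) = 1 - η / q := by rw [hs]; field_simp
  obtain ⟨C₁, hC₁, hA₁⟩ := exists_dyadicAvg_fracMax_rpow_le d hη0 hγ0 (by linarith)
  obtain ⟨C₂, hC₂, hA₂⟩ := exists_dyadicAvg_fracMax_rpow_le d hη0 (div_pos hτ0 hq1) hτ1
  obtain ⟨C₃, hC₃, hS₃⟩ := exists_tsum_min_le (β := γ) hα0 hs0 (by rw [hγs]; nlinarith)
  obtain ⟨C₄, hC₄, hS₄⟩ := exists_tsum_min_le (β := τ + 1 / q) hαη hs0
    (by rw [mul_add, hsq]; nlinarith)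
  refine ⟨(C₁ * C₃) ^ (p - 1) * (C₂ ^ (1 - 1 / q) * C₄),
    ENNReal.mul_ne_top (ENNReal.rpow_ne_top_of_nonneg hp1.le (ENNReal.mul_ne_top hC₁ hC₃))
      (ENNReal.mul_ne_top (ENNReal.rpow_ne_top_of_nonneg hq1.le hC₂) hC₄), ?_⟩
  intro V hV hM f hf
  set F : SpaceTime d → ℝ≥0∞ := fun w => V w ^ q with hF
  have hFm : Measurable F := hV.pow_const q
  -- A single zero of the maximal function forces V = 0 almost everywhere; otherwise Φ vanishes
  -- nowhere and is admissible in the Schur test.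
  by_cases hzero : ∃ z, fracMax η F z = 0
  · obtain ⟨z, hz⟩ := hzero
    refine le_of_eq_of_le ?_ zero_le
    rw [← lintegral_zero (μ := (volume : Measure (SpaceTime d)))]
    refine lintegral_congr_ae ?_
    filter_upwards [ae_eq_zero_of_fracMax_eq_zero hFm hz] with w hw
    have : V w = 0 := by simpa [hF, ENNReal.rpow_eq_zero_iff, hq0, hq0.not_gt] using hw
    simp [this]
  push Not at hzero
  set Φ := fracMax η F with hΦ
  have hΦm : Measurable Φ := measurable_fracMax η hFm
  have hΨ : ∀ (k : ℤ) z, fracMaxFrom η F k z ≤ min (Φ z) (2 ^ (-(k * s))) :=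
    fracMaxFrom_le (by linarith) hM
  have hu : ∀ z, dyadicPotential α (fun w => Φ w ^ γ) z ≤ C₁ * C₃ * Φ z ^ δ := by
    intro z
    rw [dyadicPotential_eq_tsum α (hΦm.pow_const γ)]
    calc _ ≤ ∑' k : ℤ, C₁ * (2 ^ (k * α) * min (Φ z) (2 ^ (-(k * s))) ^ γ) := by
          refine ENNReal.tsum_le_tsum fun k => ?_
          rw [mul_left_comm]
          gcongr
          refine (hA₁ F hFm k z).trans ?_
          gcongr
          exact hΨ k z
      _ ≤ C₁ * (C₃ * Φ z ^ (γ - α / s)) := by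
          rw [ENNReal.tsum_mul_left]
          gcongr
          exact hS₃ _
      _ = _ := by rw [hγ, add_sub_cancel_left, mul_assoc]
  have hv : ∀ z, dyadicPotential α (fun w => V w * Φ w ^ τ) z ≤
      C₂ ^ (1 - 1 / q) * C₄ * Φ z ^ (γ * (p - 1)) := by
    intro z
    rw [dyadicPotential_eq_tsum α (hV.fun_mul (hΦm.pow_const τ))]
    calc _ ≤ ∑' k : ℤ, C₂ ^ (1 - 1 / q) *
          (2 ^ (k * (α - η / q)) * min (Φ z) (2 ^ (-(k * s))) ^ (τ + 1 / q)) := by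
          refine ENNReal.tsum_le_tsum fun k => ?_
          calc _ ≤ 2 ^ (k * α) * (C₂ ^ (1 - 1 / q) * (2 ^ (-(k * (η / q))) *
                min (Φ z) (2 ^ (-(k * s))) ^ (τ + 1 / q))) := by
                gcongr
                refine (dyadicAvg_mul_fracMax_rpow_le hq hτ0 hV k z (hA₂ F hFm k z)).trans ?_
                gcongr
                exact hΨ k z
            _ = C₂ ^ (1 - 1 / q) * ((2 ^ (k * α) * 2 ^ (-(k * (η / q)))) *
                min (Φ z) (2 ^ (-(k * s))) ^ (τ + 1 / q)) := by ring
            _ = _ := by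
                rw [two_rpow_mul]
                congr 4
                ring
      _ ≤ C₂ ^ (1 - 1 / q) * (C₄ * Φ z ^ (τ + 1 / q - (α - η / q) / s)) := by
          rw [ENNReal.tsum_mul_left]
          gcongr
          exact hS₄ _
      _ = _ := by
          rw [mul_assoc]
          congr 3
          -- The choice α = 1/p turns 1/s into pα/s, so the exponent becomes τ + (p-1)α/s = γ(p-1).
          have hαp : α * p = 1 := by rw [hα, one_div_mul_cancel hp0.ne']
          have h1 : (α - η / q) / s = α / s + 1 / q - 1 / s := by
            rw [show 1 / q = (1 - η / q) / s by rw [← hsq]; field_simp]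
            ring
          have h2 : 1 / s = α / s * p := by rw [div_mul_eq_mul_div, hαp]
          rw [h1, h2, hτ, hγ]
          ring
  refine lintegral_mul_rpow_lintegral_le (u := fun w => Φ w ^ γ)
    (v := fun z => C₁ * C₃ * Φ z ^ δ) (measurable_uncurry_dyadicKernel α) hV (hΦm.pow_const γ)
    ((hΦm.pow_const δ).const_mul _) hp ?_ ?_ hu ?_ hf
  · refine Filter.Eventually.of_forall fun w => ?_
    exact (ENNReal.rpow_eq_zero_iff_of_pos hγ0).not.2 (hzero w)
  · filter_upwards [fracMax_ae_lt_top hη0 (by linarith) hFm hM] with w hw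
    exact ENNReal.rpow_ne_top_of_nonneg hγ0.le hw.ne
  · intro w
    have hrw : ∀ z, dyadicKernel α z w * (V z * (C₁ * C₃ * Φ z ^ δ) ^ (p - 1)) =
        (C₁ * C₃) ^ (p - 1) * (dyadicKernel α w z * (V z * Φ z ^ τ)) := by
      intro z
      rw [ENNReal.mul_rpow_of_nonneg _ _ hp1.le, ← ENNReal.rpow_mul, dyadicKernel_comm]
      ring
    simp_rw [hrw]
    rw [lintegral_const_mul _ ((measurable_dyadicKernel α w).fun_mul (hV.fun_mul (hΦm.pow_const τ))),
      ← ENNReal.rpow_mul, mul_assoc]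
    exact mul_le_mul_right (hv w) _

/-- The trace inequality for the dyadic potential. -/
lemma exists_lintegral_mul_dyadicPotential_rpow_le (d : ℕ) {p q : ℝ} (hp : 1 < p) (hq : 1 < q) :
    ∃ C : ℝ≥0∞, C ≠ ∞ ∧ ∀ (V : SpaceTime d → ℝ≥0∞) (N : ℝ≥0∞), Measurable V → N ≠ ∞ →
      (∀ (k : ℤ) (z : SpaceTime d), dyadicAvg k (fun w => V w ^ q) z ≤ N ^ q * 2 ^ (-(k * q))) →
      ∀ f : SpaceTime d → ℝ≥0∞, Measurable f →
        ∫⁻ z, V z * dyadicPotential (1 / p) f z ^ p ≤ C * N * ∫⁻ w, f w ^ p := by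
  have hq0 : 0 < q := by linarith
  obtain ⟨C, hC, h⟩ := exists_lintegral_mul_dyadicPotential_rpow_le_of_normalized d hp hq
  refine ⟨C, hC, fun V N hV hN hM f hf => ?_⟩
  -- Rescaling by `N⁻¹` is unavailable at N = 0, but there V vanishes almost everywhere.
  rcases eq_or_ne N 0 with rfl | hN0
  · have h0 : fracMax 0 (fun w => V w ^ q) (0 : SpaceTime d) = 0 := by
      refine ENNReal.iSup_eq_zero.2 fun k => ?_
      have := hM k 0
      rw [ENNReal.zero_rpow_of_pos hq0, zero_mul, nonpos_iff_eq_zero] at this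
      rw [this, mul_zero]
    refine le_of_eq_of_le ?_ zero_le
    rw [← lintegral_zero (μ := (volume : Measure (SpaceTime d)))]
    refine lintegral_congr_ae ?_
    filter_upwards [ae_eq_zero_of_fracMax_eq_zero (hV.pow_const q) h0] with w hw
    have : V w = 0 := by simpa [ENNReal.rpow_eq_zero_iff, hq0, hq0.not_gt] using hw
    simp [this]
  · have hNN : N * N⁻¹ = 1 := ENNReal.mul_inv_cancel hN0 hN
    have key := h (fun w => N⁻¹ * V w) (hV.const_mul _) (fun k z => by
      simp_rw [ENNReal.mul_rpow_of_nonneg _ _ hq0.le]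
      rw [dyadicAvg_const_mul _ _ (hV.pow_const q)]
      refine (mul_le_mul_right (hM k z) _).trans (le_of_eq ?_)
      rw [← mul_assoc, ← ENNReal.mul_rpow_of_nonneg _ _ hq0.le, mul_comm _ N, hNN,
        ENNReal.one_rpow, one_mul]) f hf
    calc _ = N * ∫⁻ z, N⁻¹ * V z * dyadicPotential (1 / p) f z ^ p := by
          rw [← lintegral_const_mul _ ((hV.const_mul _).fun_mul
            ((measurable_dyadicPotential _ hf).pow_const _))]
          refine lintegral_congr fun z => ?_
          rw [← mul_assoc, ← mul_assoc, hNN, one_mul]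
      _ ≤ N * (C * ∫⁻ w, f w ^ p) := by gcongr
      _ = _ := by ring

/-! ### Almost everywhere finiteness of the potential -/

/-- The indicator of a ball is a Morrey weight of exponent 2: for k ≥ n its averages decay like
2^(-(k-n)(d+2)), and d + 2 ≥ 2. -/
lemma dyadicAvg_indicator_rpow_le (n k : ℤ) (z : SpaceTime d) :
    dyadicAvg k (fun w => (dyadicBall n (0 : SpaceTime d)).indicator 1 w ^ (2 : ℝ)) z ≤
      ((unitVolume d ^ (1 / 2 : ℝ)) * 2 ^ (n : ℝ)) ^ (2 : ℝ) * 2 ^ (-(k * (2 : ℝ))) := by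
  have hN : ((unitVolume d ^ (1 / 2 : ℝ)) * 2 ^ (n : ℝ)) ^ (2 : ℝ) =
      unitVolume d * 2 ^ ((n : ℝ) * 2) := by
    rw [ENNReal.mul_rpow_of_nonneg _ _ two_pos.le, ← ENNReal.rpow_mul, two_rpow_rpow]
    norm_num
  rw [hN, mul_assoc, two_rpow_mul]
  rcases le_total k n with h | h
  · calc _ ≤ dyadicAvg k (fun _ => 1) z := by
          refine dyadicAvg_mono fun y _ => ?_
          by_cases hy : y ∈ dyadicBall n (0 : SpaceTime d) <;> simp [hy]
      _ = unitVolume d * 2 ^ (0 : ℝ) := by rw [dyadicAvg_const]; simp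
      _ ≤ _ := by
          gcongr
          · exact one_le_two
          · have : (k : ℝ) ≤ n := by exact_mod_cast h
            linarith
  · have : ∫⁻ w in dyadicBall k z, (dyadicBall n (0 : SpaceTime d)).indicator 1 w ^ (2 : ℝ) ≤
        unitVolume d * 2 ^ (n * ((d : ℝ) + 2)) := by
      rw [← volume_dyadicBall n 0, ← lintegral_indicator_one (measurableSet_dyadicBall n 0)]
      refine (setLIntegral_le_lintegral _ _).trans (lintegral_mono fun w => ?_)
      by_cases hy : w ∈ dyadicBall n (0 : SpaceTime d) <;> simp [hy]
    calc _ ≤ (2 : ℝ≥0∞) ^ (-(k * ((d : ℝ) + 2))) *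
          (unitVolume d * 2 ^ (n * ((d : ℝ) + 2))) := mul_le_mul_right this _
      _ = unitVolume d * 2 ^ (n * ((d : ℝ) + 2) + -(k * ((d : ℝ) + 2))) := by
          rw [← two_rpow_mul]; ring
      _ ≤ _ := by
          refine mul_le_mul_right (two_rpow_le ?_) _
          have h1 : (n : ℝ) ≤ k := by exact_mod_cast h
          have h2 : (0 : ℝ) ≤ d := by positivity
          nlinarith

/-- Apply the trace inequality with the indicator of a large ball as weight; no b is involved. -/
lemma dyadicPotential_ae_lt_top {p : ℝ} (hp : 1 < p) {f : SpaceTime d → ℝ≥0∞} (hf : Measurable f)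
    (hfp : ∫⁻ w, f w ^ p ≠ ∞) : ∀ᵐ z, dyadicPotential (1 / p) f z < ∞ := by
  obtain ⟨C, hC, h⟩ := exists_lintegral_mul_dyadicPotential_rpow_le d hp one_lt_two
  rw [← Measure.restrict_univ (μ := (volume : Measure (SpaceTime d))), ← iUnion_dyadicBall 0,
    ae_restrict_iUnion_iff]
  intro n
  have hm := measurableSet_dyadicBall n (0 : SpaceTime d)
  have hNt : (unitVolume d ^ (1 / 2 : ℝ)) * 2 ^ ((n : ℤ) : ℝ) ≠ ∞ :=
    ENNReal.mul_ne_top (ENNReal.rpow_ne_top_of_nonneg (by norm_num) unitVolume_ne_top)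
      (two_rpow_ne_top _)
  have key := h ((dyadicBall n (0 : SpaceTime d)).indicator 1) _ (measurable_one.indicator hm) hNt
    (dyadicAvg_indicator_rpow_le n) f hf
  have hint : ∫⁻ z in dyadicBall n (0 : SpaceTime d), dyadicPotential (1 / p) f z ^ p ≠ ∞ := by
    rw [setLIntegral_dyadicBall_eq]
    refine ne_top_of_le_ne_top (ENNReal.mul_ne_top (ENNReal.mul_ne_top hC hNt) hfp) ?_
    refine le_trans (le_of_eq (lintegral_congr fun z => ?_)) key
    by_cases hz : z ∈ dyadicBall n (0 : SpaceTime d) <;> simp [hz]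
  filter_upwards [ae_lt_top ((measurable_dyadicPotential _ hf).pow_const p) hint] with z hz
  rwa [ENNReal.rpow_lt_top_iff_of_pos (by linarith)] at hz

/-! ### Comparison of symmetric balls with one-sided cylinders -/

/-- The base is moved back by 4^k in time; the duration 2·4^k of the ball then fits into 4^(k+1). -/
lemma dyadicBall_subset_cylinder (k : ℤ) (z : SpaceTime d) :
    dyadicBall k z ⊆ cylinder ((2 : ℝ) ^ (k + 1)) (z.1 - ((2 : ℝ) ^ k) ^ 2, z.2) := by
  rintro w ⟨h1, h2⟩
  rw [Metric.mem_closedBall, Real.dist_eq, abs_le] at h1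
  rw [Metric.mem_closedBall, dist_comm, dist_eq_norm] at h2
  have h0 : (0 : ℝ) < 2 ^ k := by positivity
  rw [zpow_add_one₀ two_ne_zero]
  refine ⟨?_, ?_, ?_⟩ <;> dsimp only <;> nlinarith

lemma cylinder_subset_dyadicBall (k : ℤ) (z : SpaceTime d) :
    cylinder ((2 : ℝ) ^ k) z ⊆ dyadicBall k z := by
  rintro w ⟨h1, h2, h3⟩
  refine ⟨?_, ?_⟩
  · rw [Metric.mem_closedBall, Real.dist_eq, abs_le]
    constructor <;> nlinarith [sq_nonneg ((2 : ℝ) ^ k)]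
  · rwa [Metric.mem_closedBall, dist_comm, dist_eq_norm]

lemma dyadicAvg_enorm_rpow_le {q : ℝ} (hq : 1 < q) (b : SpaceTime d → EuclideanSpace ℝ (Fin d))
    (k : ℤ) (z : SpaceTime d) :
    dyadicAvg k (fun w => ‖b w‖ₑ ^ q) z ≤
      ((unitVolume d * 2 ^ ((d : ℝ) + 2)) ^ (1 / q) * morreyNorm q b) ^ q * 2 ^ (-(k * q)) := by
  have hq0 : 0 < q := by linarith
  set z' : SpaceTime d := (z.1 - ((2 : ℝ) ^ k) ^ 2, z.2)
  set Q := cylinder ((2 : ℝ) ^ (k + 1)) z' with hQ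
  set I := ∫⁻ w in Q, ‖b w‖ₑ ^ q with hI
  have hvle : volume Q ≤ unitVolume d * 2 ^ (((k + 1 : ℤ) : ℝ) * ((d : ℝ) + 2)) := by
    rw [← volume_dyadicBall (k + 1) z']
    exact measure_mono (cylinder_subset_dyadicBall (k + 1) z')
  have hvt : volume Q ≠ ∞ :=
    ne_top_of_le_ne_top (ENNReal.mul_ne_top unitVolume_ne_top (two_rpow_ne_top _)) hvle
  have hv0 : volume Q ≠ 0 := by
    intro h
    have := measure_mono_null (dyadicBall_subset_cylinder k z) h
    rw [volume_dyadicBall] at this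
    exact mul_ne_zero unitVolume_ne_zero (two_rpow_ne_zero _) this
  have hN : 2 ^ (((k + 1 : ℤ) : ℝ)) * ((volume Q)⁻¹ * I) ^ (1 / q) ≤ morreyNorm q b := by
    rw [← ofReal_two_zpow]
    exact le_iSup_of_le ((2 : ℝ) ^ (k + 1)) (le_iSup_of_le (by positivity)
      (le_iSup_of_le z' le_rfl))
  have hNq : 2 ^ (((k + 1 : ℤ) : ℝ) * q) * ((volume Q)⁻¹ * I) ≤ morreyNorm q b ^ q := by
    have := ENNReal.rpow_le_rpow hN hq0.le
    rwa [ENNReal.mul_rpow_of_nonneg _ _ hq0.le, two_rpow_rpow, ← ENNReal.rpow_mul,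
      one_div_mul_cancel hq0.ne', ENNReal.rpow_one] at this
  have hIle : I ≤ volume Q * (2 ^ (-(((k + 1 : ℤ) : ℝ) * q)) * morreyNorm q b ^ q) := by
    calc I = volume Q * (2 ^ (-(((k + 1 : ℤ) : ℝ) * q)) *
          (2 ^ (((k + 1 : ℤ) : ℝ) * q) * ((volume Q)⁻¹ * I))) := by
          rw [← mul_assoc (2 ^ _) (2 ^ _), two_rpow_mul, neg_add_cancel, ENNReal.rpow_zero, one_mul,
            ← mul_assoc, ENNReal.mul_inv_cancel hv0 hvt, one_mul]
      _ ≤ _ := by gcongr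
  calc _ ≤ (2 : ℝ≥0∞) ^ (-(k * ((d : ℝ) + 2))) * I :=
        mul_le_mul_right (lintegral_mono_set (dyadicBall_subset_cylinder k z)) _
    _ ≤ (2 : ℝ≥0∞) ^ (-(k * ((d : ℝ) + 2))) *
        ((unitVolume d * 2 ^ (((k + 1 : ℤ) : ℝ) * ((d : ℝ) + 2))) *
          (2 ^ (-(k * q)) * morreyNorm q b ^ q)) := by
        gcongr
        refine hIle.trans (mul_le_mul' hvle (mul_le_mul_left (two_rpow_le ?_) _))
        push_cast
        nlinarith
    _ = _ := by
        rw [ENNReal.mul_rpow_of_nonneg _ _ hq0.le, ← ENNReal.rpow_mul,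
          one_div_mul_cancel hq0.ne', ENNReal.rpow_one]
        have : (d : ℝ) + 2 = -(k * ((d : ℝ) + 2)) + ((k + 1 : ℤ) : ℝ) * ((d : ℝ) + 2) := by
          push_cast; ring
        nth_rewrite 3 [this]
        rw [← two_rpow_mul]
        ring

end

/-! ### The fractional heat kernel -/

section

variable {d : ℕ}

/-- The inequality y ≤ e^y at y = x/(16m), raised to the power m. -/
lemma rpow_le_mul_exp {m x : ℝ} (hm : 0 < m) (hx : 0 ≤ x) :
    x ^ m ≤ (16 * m) ^ m * Real.exp (x / 16) := by
  have h1 : x = 16 * m * (x / (16 * m)) := by field_simp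
  have h2 : x / (16 * m) ≤ Real.exp (x / (16 * m)) := by
    linarith [Real.add_one_le_exp (x / (16 * m))]
  calc x ^ m = (16 * m) ^ m * (x / (16 * m)) ^ m := by
        rw [← Real.mul_rpow (by positivity) (by positivity), ← h1]
    _ ≤ (16 * m) ^ m * Real.exp (x / (16 * m)) ^ m := by gcongr
    _ = _ := by
        rw [← Real.exp_mul]
        congr 2
        field_simp

/-- Here s is comparable to the parabolic size max(√τ, r). If time dominates, the power of τ
suffices; if space dominates, r²/(4τ) ≥ s²/(16τ) and the Gaussian absorbs the power. -/
lemma rpow_neg_mul_exp_le {m τ s r : ℝ} (hm : 0 < m) (hτ : 0 < τ) (hs : 0 < s)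
    (h : s ^ 2 ≤ 4 * τ ∨ s ≤ 2 * r) :
    τ ^ (-m) * Real.exp (-r ^ 2 / (4 * τ)) ≤ (4 ^ m + (16 * m) ^ m) * (s ^ 2) ^ (-m) := by
  have hx : 0 < s ^ 2 / τ := by positivity
  have hτs : τ ^ (-m) = (s ^ 2) ^ (-m) * (s ^ 2 / τ) ^ m := by
    rw [Real.div_rpow (by positivity) hτ.le, Real.rpow_neg hτ.le, Real.rpow_neg (by positivity)]
    have : (s ^ 2) ^ m ≠ 0 := by positivity
    field_simp
  have key : (s ^ 2 / τ) ^ m * Real.exp (-r ^ 2 / (4 * τ)) ≤ 4 ^ m + (16 * m) ^ m := by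
    rcases h with h | h
    · have h1 : (s ^ 2 / τ) ^ m ≤ 4 ^ m := by
        gcongr
        rwa [div_le_iff₀ hτ]
      have h2 : Real.exp (-r ^ 2 / (4 * τ)) ≤ 1 := by
        rw [Real.exp_le_one_iff, neg_div, neg_nonpos]
        positivity
      have h3 : (0 : ℝ) ≤ (16 * m) ^ m := by positivity
      have h4 : (s ^ 2 / τ) ^ m * Real.exp (-r ^ 2 / (4 * τ)) ≤ 4 ^ m * 1 := by gcongr
      linarith
    · have h1 : -r ^ 2 / (4 * τ) ≤ -(s ^ 2 / τ / 16) := by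
        rw [neg_div, neg_le_neg_iff, div_div, div_le_div_iff₀ (by positivity) (by positivity)]
        nlinarith [mul_nonneg hτ.le (sub_nonneg.2 (pow_le_pow_left₀ hs.le h 2))]
      calc _ ≤ (16 * m) ^ m * Real.exp (s ^ 2 / τ / 16) * Real.exp (-(s ^ 2 / τ / 16)) := by
            gcongr
            exact rpow_le_mul_exp hm hx.le
        _ = (16 * m) ^ m := by rw [mul_assoc, ← Real.exp_add, add_neg_cancel, Real.exp_zero, mul_one]
        _ ≤ _ := le_add_of_nonneg_left (by positivity)
  calc _ = (s ^ 2) ^ (-m) * ((s ^ 2 / τ) ^ m * Real.exp (-r ^ 2 / (4 * τ))) := by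
        rw [hτs]; ring
    _ ≤ (s ^ 2) ^ (-m) * (4 ^ m + (16 * m) ^ m) := by gcongr
    _ = _ := mul_comm _ _

lemma fracHeatKernel_nonneg (α : ℝ) (w : SpaceTime d) : 0 ≤ fracHeatKernel α w := by
  rw [fracHeatKernel]
  split_ifs with h
  · have := Real.pi_pos
    positivity
  · exact le_rfl

lemma fracHeatKernel_le {α : ℝ} {w : SpaceTime d} (hw : 0 < w.1) :
    fracHeatKernel α w ≤
      w.1 ^ (-(((d : ℝ) + 2 - α) / 2)) * Real.exp (-‖w.2‖ ^ 2 / (4 * w.1)) := by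
  rw [fracHeatKernel, if_pos hw]
  refine mul_le_mul_of_nonneg_right ?_ (Real.exp_nonneg _)
  have h1 : w.1 ≤ 4 * Real.pi * w.1 := by nlinarith [Real.pi_gt_three]
  calc 1 / (4 * Real.pi * w.1) ^ ((d : ℝ) / 2) * (1 / w.1 ^ ((2 - α) / 2))
      ≤ 1 / w.1 ^ ((d : ℝ) / 2) * (1 / w.1 ^ ((2 - α) / 2)) := by gcongr
    _ = _ := by
        rw [one_div, one_div, ← mul_inv, ← Real.rpow_add hw, ← Real.rpow_neg hw.le]
        congr 1; ring

lemma measurable_fracHeatKernel (α : ℝ) : Measurable (fracHeatKernel (d := d) α) := by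
  refine Measurable.ite (measurableSet_lt measurable_const measurable_fst) ?_ measurable_const
  fun_prop

lemma exists_enorm_fracHeatKernel_le (d : ℕ) {α : ℝ} (hα : α < 2) :
    ∃ C : ℝ≥0∞, C ≠ ∞ ∧ ∀ z w : SpaceTime d,
      ‖fracHeatKernel α (z - w)‖ₑ ≤ C * dyadicKernel α z w := by
  set m : ℝ := ((d : ℝ) + 2 - α) / 2 with hm
  have hm0 : 0 < m := by
    have : (0 : ℝ) ≤ d := by positivity
    rw [hm]; linarith
  refine ⟨ENNReal.ofReal (4 ^ m + (16 * m) ^ m), ENNReal.ofReal_ne_top, fun z w => ?_⟩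
  by_cases hpos : 0 < (z - w).1
  swap
  · have : fracHeatKernel α (z - w) = 0 := by rw [fracHeatKernel, if_neg hpos]
    simp [this]
  set τ := (z - w).1 with hτ
  set r := ‖(z - w).2‖ with hr
  obtain ⟨n, hn1, hn2⟩ := exists_mem_Ioc_zpow
    (lt_max_of_lt_left (Real.sqrt_pos.2 hpos) : 0 < max √τ r) (one_lt_two (α := ℝ))
  set s : ℝ := 2 ^ (n + 1) with hs
  have hs0 : 0 < s := by positivity
  have hs2 : s = 2 * 2 ^ n := by rw [hs, zpow_add_one₀ two_ne_zero]; ring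
  have hsq := Real.sq_sqrt hpos.le
  have hmem : w ∈ dyadicBall (n + 1) z := by
    refine ⟨?_, ?_⟩
    · rw [Metric.mem_closedBall, dist_comm, Real.dist_eq]
      have h1 : z.1 - w.1 = τ := rfl
      rw [h1, abs_of_pos hpos, ← hsq]
      exact pow_le_pow_left₀ (Real.sqrt_nonneg _) ((le_max_left _ _).trans hn2) 2
    · rw [Metric.mem_closedBall, dist_comm, dist_eq_norm]
      exact (le_max_right _ _).trans hn2
  have hcase : s ^ 2 ≤ 4 * τ ∨ s ≤ 2 * r := by
    rcases lt_max_iff.1 hn1 with h | h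
    · left
      rw [hs2, mul_pow, ← hsq]
      have := pow_le_pow_left₀ (by positivity) h.le 2
      linarith
    · right
      rw [hs2]; linarith
  have hbound := (fracHeatKernel_le hpos).trans (rpow_neg_mul_exp_le hm0 hpos hs0 hcase)
  rw [Real.enorm_of_nonneg (fracHeatKernel_nonneg _ _)]
  refine (ENNReal.ofReal_le_ofReal hbound).trans ?_
  rw [ENNReal.ofReal_mul (by positivity)]
  gcongr
  -- One term of the dyadic sum is enough, since (s²)^(-m) = 2^((n+1)(α-(d+2))).
  refine le_trans (le_of_eq ?_) (ENNReal.le_tsum (n + 1))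
  rw [Set.indicator_of_mem hmem, Pi.one_apply, mul_one,
    ← ENNReal.ofReal_rpow_of_pos (by positivity), ENNReal.ofReal_pow hs0.le, hs, ofReal_two_zpow,
    ← ENNReal.rpow_natCast, two_rpow_rpow, two_rpow_rpow]
  congr 1
  push_cast
  ring

end

/-! ### Bounded operators on `L^p` -/

section

variable {d : ℕ}

lemma lintegral_enorm_rpow_eq {p : ℝ} (hp : 0 < p) (f : SpaceTime d → ℝ) :
    ∫⁻ w, ‖f w‖ₑ ^ p = eLpNorm f (ENNReal.ofReal p) volume ^ p := by
  rw [eLpNorm_eq_lintegral_rpow_enorm_toReal (by simpa using hp) ENNReal.ofReal_ne_top,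
    ENNReal.toReal_ofReal hp.le, ← ENNReal.rpow_mul, one_div_mul_cancel hp.ne', ENNReal.rpow_one]

/-- A kernel dominated by the dyadic kernel, multiplied by a function satisfying a trace
inequality, defines a bounded operator on `L^p`. -/
lemma exists_clm_of_trace_inequality {p : ℝ} (hp : 1 < p) [Fact (1 ≤ ENNReal.ofReal p)]
    {K : SpaceTime d → SpaceTime d → ℝ} (hK : Measurable (Function.uncurry K)) {C : ℝ≥0∞}
    (hC : C ≠ ∞) (hKC : ∀ z w, ‖K z w‖ₑ ≤ C * dyadicKernel (1 / p) z w) {β : SpaceTime d → ℝ}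
    (hβ : AEStronglyMeasurable β volume) {A : ℝ≥0∞} (hA : A ≠ ∞)
    (htrace : ∀ f : SpaceTime d → ℝ≥0∞, Measurable f →
      ∫⁻ z, ‖β z‖ₑ ^ p * dyadicPotential (1 / p) f z ^ p ≤ A ^ p * ∫⁻ w, f w ^ p) :
    ∃ T : Lp ℝ (ENNReal.ofReal p) (volume : Measure (SpaceTime d)) →L[ℝ]
        Lp ℝ (ENNReal.ofReal p) (volume : Measure (SpaceTime d)),
      (∀ f : Lp ℝ (ENNReal.ofReal p) (volume : Measure (SpaceTime d)),
        ∀ᵐ z, Integrable (fun w => K z w * f w) ∧ T f z = β z * ∫ w, K z w * f w) ∧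
      ‖T‖ ≤ (C * A).toReal := by
  have hp0 : 0 < p := by linarith
  have hKz : ∀ z, Measurable (K z) := fun z => hK.of_uncurry_left
  have hbound : ∀ (f : SpaceTime d → ℝ), Measurable f → ∀ z,
      ∫⁻ w, ‖K z w * f w‖ₑ ≤ C * dyadicPotential (1 / p) (fun w => ‖f w‖ₑ) z := by
    intro f hf z
    rw [dyadicPotential, ← lintegral_const_mul _ ((measurable_dyadicKernel _ z).fun_mul hf.enorm)]
    refine lintegral_mono fun w => ?_
    rw [enorm_mul, ← mul_assoc]
    exact mul_le_mul_left (hKC z w) _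
  have hint : ∀ f : Lp ℝ (ENNReal.ofReal p) (volume : Measure (SpaceTime d)),
      ∀ᵐ z, Integrable (fun w => K z w * f w) := by
    intro f
    have hfm : Measurable f := (Lp.stronglyMeasurable f).measurable
    have hft : ∫⁻ w, ‖f w‖ₑ ^ p ≠ ∞ := by
      rw [lintegral_enorm_rpow_eq hp0]
      exact ENNReal.rpow_ne_top_of_nonneg hp0.le (Lp.eLpNorm_ne_top f)
    filter_upwards [dyadicPotential_ae_lt_top hp hfm.enorm hft] with z hz
    exact ⟨((hKz z).mul hfm).aestronglyMeasurable,
      (hbound f hfm z).trans_lt (ENNReal.mul_lt_top hC.lt_top hz)⟩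
  have hnorm : ∀ f : Lp ℝ (ENNReal.ofReal p) (volume : Measure (SpaceTime d)),
      eLpNorm (fun z => β z * ∫ w, K z w * f w) (ENNReal.ofReal p) volume ≤ C * A * ‖f‖ₑ := by
    intro f
    have hfm : Measurable f := (Lp.stronglyMeasurable f).measurable
    rw [← ENNReal.rpow_le_rpow_iff hp0, ← lintegral_enorm_rpow_eq hp0]
    calc _ ≤ ∫⁻ z, C ^ p * (‖β z‖ₑ ^ p * dyadicPotential (1 / p) (fun w => ‖f w‖ₑ) z ^ p) := by
          refine lintegral_mono fun z => ?_
          rw [mul_left_comm, ← ENNReal.mul_rpow_of_nonneg _ _ hp0.le, enorm_mul,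
            ← ENNReal.mul_rpow_of_nonneg _ _ hp0.le]
          gcongr
          -- Valid for every z: where the integrand is not integrable the Bochner integral is 0.
          exact (enorm_integral_le_lintegral_enorm _).trans (hbound f hfm z)
      _ ≤ C ^ p * (A ^ p * ∫⁻ w, ‖f w‖ₑ ^ p) := by
          rw [lintegral_const_mul' _ _ (ENNReal.rpow_ne_top_of_nonneg hp0.le hC)]
          gcongr
          exact htrace _ hfm.enorm
      _ = _ := by
          rw [lintegral_enorm_rpow_eq hp0, ENNReal.mul_rpow_of_nonneg _ _ hp0.le,
            ENNReal.mul_rpow_of_nonneg _ _ hp0.le, Lp.enorm_def, mul_assoc]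
  have hmem : ∀ f : Lp ℝ (ENNReal.ofReal p) (volume : Measure (SpaceTime d)),
      MemLp (fun z => β z * ∫ w, K z w * f w) (ENNReal.ofReal p) volume := by
    intro f
    have hfm : Measurable f := (Lp.stronglyMeasurable f).measurable
    refine ⟨hβ.mul ?_, (hnorm f).trans_lt
      (ENNReal.mul_lt_top (ENNReal.mul_lt_top hC.lt_top hA.lt_top) enorm_lt_top)⟩
    exact (StronglyMeasurable.integral_prod_right
      (f := fun z w => K z w * f w) (hK.mul (hfm.comp measurable_snd)).stronglyMeasurable
      ).aestronglyMeasurable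
  let L : Lp ℝ (ENNReal.ofReal p) (volume : Measure (SpaceTime d)) →ₗ[ℝ]
      Lp ℝ (ENNReal.ofReal p) (volume : Measure (SpaceTime d)) :=
    { toFun := fun f => (hmem f).toLp
      map_add' := fun f g => by
        rw [← MemLp.toLp_add]
        refine MemLp.toLp_congr _ _ ?_
        filter_upwards [hint f, hint g] with z hf hg
        -- Additivity needs genuine convergence of both integrals, available for almost every z.
        rw [Pi.add_apply, ← mul_add, ← integral_add hf hg]
        congr 1
        refine integral_congr_ae ?_
        filter_upwards [Lp.coeFn_add f g] with w hw
        rw [hw, Pi.add_apply, mul_add]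
      map_smul' := fun c f => by
        rw [RingHom.id_apply, ← MemLp.toLp_const_smul c (hmem f)]
        refine MemLp.toLp_congr _ _ (Filter.Eventually.of_forall fun z => ?_)
        change _ = c * (β z * ∫ w, K z w * f w)
        rw [mul_left_comm, ← integral_const_mul c]
        refine congrArg (β z * ·) (integral_congr_ae ?_)
        filter_upwards [Lp.coeFn_smul c f] with w hw
        rw [hw, Pi.smul_apply, smul_eq_mul, mul_left_comm] }
  refine ⟨L.mkContinuous (C * A).toReal fun f => ?_, fun f => ?_,
    L.mkContinuous_norm_le ENNReal.toReal_nonneg _⟩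
  · change ‖(hmem f).toLp‖ ≤ _
    rw [Lp.norm_toLp, ← toReal_enorm f, ← ENNReal.toReal_mul]
    exact ENNReal.toReal_mono
      (ENNReal.mul_ne_top (ENNReal.mul_ne_top hC hA) enorm_ne_top) (hnorm f)
  · filter_upwards [hint f, (hmem f).coeFn_toLp] with z h1 h2
    exact ⟨h1, h2⟩

/-- The trace inequality for weights `|b|` with `b` in a parabolic Morrey class. -/
lemma exists_lintegral_enorm_mul_dyadicPotential_rpow_le (d : ℕ) {p q : ℝ} (hp : 1 < p)
    (hq : 1 < q) :
    ∃ C : ℝ≥0∞, C ≠ ∞ ∧ ∀ b : SpaceTime d → EuclideanSpace ℝ (Fin d), MemMorrey q b →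
      ∀ f : SpaceTime d → ℝ≥0∞, Measurable f →
        ∫⁻ z, ‖b z‖ₑ * dyadicPotential (1 / p) f z ^ p ≤
          C * morreyNorm q b * ∫⁻ w, f w ^ p := by
  obtain ⟨C, hC, h⟩ := exists_lintegral_mul_dyadicPotential_rpow_le d hp hq
  have hKt : (unitVolume d * 2 ^ ((d : ℝ) + 2)) ^ (1 / q) ≠ ∞ :=
    ENNReal.rpow_ne_top_of_nonneg (by positivity)
      (ENNReal.mul_ne_top unitVolume_ne_top (two_rpow_ne_top _))
  refine ⟨_, ENNReal.mul_ne_top hC hKt, fun b hb f hf => ?_⟩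
  -- The weight is only almost everywhere measurable; a measurable representative has the same
  -- averages.
  have hbm : AEMeasurable (fun z => ‖b z‖ₑ) volume := hb.aestronglyMeasurable.enorm
  have havg : ∀ (k : ℤ) (z : SpaceTime d), dyadicAvg k (fun w => hbm.mk _ w ^ q) z =
      dyadicAvg k (fun w => ‖b w‖ₑ ^ q) z := by
    intro k z
    rw [dyadicAvg, dyadicAvg]
    congr 1
    refine lintegral_congr_ae (ae_restrict_of_ae ?_)
    filter_upwards [hbm.ae_eq_mk] with w hw
    rw [hw]
  have key := h (hbm.mk _) _ hbm.measurable_mk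
    (ENNReal.mul_ne_top hKt hb.morreyNorm_lt_top.ne)
    (fun k z => (havg k z).trans_le (dyadicAvg_enorm_rpow_le hq b k z)) f hf
  calc _ = ∫⁻ z, hbm.mk _ z * dyadicPotential (1 / p) f z ^ p := by
        refine lintegral_congr_ae ?_
        filter_upwards [hbm.ae_eq_mk] with w hw
        rw [hw]
    _ ≤ _ := key
    _ = _ := by ring

end

end ParabolicMorrey

end

/-! ### Boundedness of the forward and backward operators -/

theorem proposition1 (d : ℕ) (hd : 3 ≤ d) (q : ℝ) (hq : 1 < q) (hqd : q ≤ d + 2)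
    (p : ℝ) (hp : 1 < p) [Fact (1 ≤ ENNReal.ofReal p)] :
    ∃ c : ℝ, ∀ b : ParabolicMorrey.SpaceTime d → EuclideanSpace ℝ (Fin d),
      ParabolicMorrey.MemMorrey q b →
      (∃ T : Lp ℝ (ENNReal.ofReal p) (volume : Measure (ParabolicMorrey.SpaceTime d)) →L[ℝ]
            Lp ℝ (ENNReal.ofReal p) (volume : Measure (ParabolicMorrey.SpaceTime d)),
        (∀ f : Lp ℝ (ENNReal.ofReal p) (volume : Measure (ParabolicMorrey.SpaceTime d)),
          ∀ᵐ z, Integrable (fun w => ParabolicMorrey.fracHeatKernel (1 / p) (z - w) * f w) ∧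
            T f z = ‖b z‖ ^ (1 / p) * ParabolicMorrey.forwardPotential (1 / p) f z) ∧
        ‖T‖ ≤ c * (ParabolicMorrey.morreyNorm q b).toReal ^ (1 / p)) ∧
      (∃ T : Lp ℝ (ENNReal.ofReal p) (volume : Measure (ParabolicMorrey.SpaceTime d)) →L[ℝ]
            Lp ℝ (ENNReal.ofReal p) (volume : Measure (ParabolicMorrey.SpaceTime d)),
        (∀ f : Lp ℝ (ENNReal.ofReal p) (volume : Measure (ParabolicMorrey.SpaceTime d)),
          ∀ᵐ z, Integrable (fun w => ParabolicMorrey.fracHeatKernel (1 / p) (w - z) * f w) ∧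
            T f z = ‖b z‖ ^ (1 / p) * ParabolicMorrey.backwardPotential (1 / p) f z) ∧
        ‖T‖ ≤ c * (ParabolicMorrey.morreyNorm q b).toReal ^ (1 / p)) := by
  have hp0 : 0 < p := by linarith
  have hα : 1 / p < 2 := by rw [div_lt_iff₀ hp0]; linarith
  obtain ⟨C, hC, htrace⟩ :=
    ParabolicMorrey.exists_lintegral_enorm_mul_dyadicPotential_rpow_le d hp hq
  obtain ⟨K, hK, hker⟩ := ParabolicMorrey.exists_enorm_fracHeatKernel_le d hα
  refine ⟨(K * C ^ (1 / p)).toReal, fun b hb => ?_⟩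
  set N := ParabolicMorrey.morreyNorm q b with hN
  have hβ : AEStronglyMeasurable (fun z => ‖b z‖ ^ (1 / p)) volume :=
    (hb.aestronglyMeasurable.norm.aemeasurable.pow_const _).aestronglyMeasurable
  have hA : (C * N) ^ (1 / p) ≠ ∞ := ENNReal.rpow_ne_top_of_nonneg (by positivity)
    (ENNReal.mul_ne_top hC hb.morreyNorm_lt_top.ne)
  have hβp : ∀ z, ‖‖b z‖ ^ (1 / p)‖ₑ ^ p = ‖b z‖ₑ := by
    intro z
    rw [Real.enorm_rpow_of_nonneg (norm_nonneg _) (by positivity), enorm_norm, ← ENNReal.rpow_mul,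
      one_div_mul_cancel hp0.ne', ENNReal.rpow_one]
  have ht : ∀ f : ParabolicMorrey.SpaceTime d → ℝ≥0∞, Measurable f →
      ∫⁻ z, ‖‖b z‖ ^ (1 / p)‖ₑ ^ p * ParabolicMorrey.dyadicPotential (1 / p) f z ^ p ≤
        ((C * N) ^ (1 / p)) ^ p * ∫⁻ w, f w ^ p := by
    intro f hf
    simp_rw [hβp]
    rw [← ENNReal.rpow_mul, one_div_mul_cancel hp0.ne', ENNReal.rpow_one]
    exact htrace b hb f hf
  -- The trace constant is linear in N, so its p-th root supplies the power 1/p of the Morrey norm.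
  have hconst : (K * (C * N) ^ (1 / p)).toReal = (K * C ^ (1 / p)).toReal * N.toReal ^ (1 / p) := by
    rw [ENNReal.mul_rpow_of_nonneg _ _ (by positivity), ← mul_assoc, ENNReal.toReal_mul,
      ENNReal.toReal_rpow]
  have hmeas := ParabolicMorrey.measurable_fracHeatKernel (d := d) (1 / p)
  rw [← hconst]
  exact ⟨ParabolicMorrey.exists_clm_of_trace_inequality hp
      (K := fun z w => ParabolicMorrey.fracHeatKernel (1 / p) (z - w))
      (hmeas.comp (measurable_fst.sub measurable_snd)) hK hker hβ hA ht,
    ParabolicMorrey.exists_clm_of_trace_inequality hp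
      (K := fun z w => ParabolicMorrey.fracHeatKernel (1 / p) (w - z))
      (hmeas.comp (measurable_snd.sub measurable_fst)) hK
      -- Symmetry of the dyadic kernel carries the forward estimate to the backward one with the
      -- same constant.
      (fun z w => (hker w z).trans_eq (by rw [ParabolicMorrey.dyadicKernel_comm])) hβ hA ht⟩
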